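/- **Setting.** Let $N,d,n_x,n_\rho\ge 0$ and $\nu\ge 1$ be integers, $\mathcal P\subseteq\mathbb R^{n_\rho}$, and let $A(\cdot),B_q(\cdot),B_p(\cdot),C(\cdot)$ be matrix functions on $\mathbb R^{n_\rho}$ of sizes $n_x\times n_x$, $n_x\times d$, $n_x\times d$, $d\times n_x$, with $C$ bounded on $\mathcal P$ (automatic if $\mathcal P$ is compact and $C$ continuous). For $k_d,k_p\in\mathbb R$ put $$A_G=\begin{bmatrix}A&B_q&B_p\\0&0&I_d\\0&0&-k_dI_d\end{bmatrix},\quad B_G=\begin{bmatrix}0\\0\\-k_pI_d\end{bmatrix},\quad C_G=\begin{bmatrix}C&0&0\end{bmatrix},$$ and for $\rho=(\rho_1,\dots,\rho_N)$ let $\hat A_G(\rho),\hat B_G(\rho),\hat C_G(\rho)$ be the block-diagonal matrices with blocks $A_G(\rho_i),B_G(\rho_i),C_G(\rho_i)$. Let $0<m\le L$ and $f\in\mathcal S(m,L)$ on $\mathbb R^{Nd}$, i.e. $f$ is $C^1$ and $m\|y_1-y_2\|^2\le(\nabla f(y_1)-\nabla f(y_2))^T(y_1-y_2)\le L\|y_1-y_2\|^2$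 for all $y_1,y_2$. Let $y_*$ be the minimizer of $f$ and let $\eta_*$ satisfy $\hat A_G(\bar\rho)\eta_*=0$ and $\hat C_G(\bar\rho)\eta_*=y_*$ for all $\bar\rho\in\mathcal P^N$. Let $g:\mathbb R^{N(n_x+2d)}\to(\mathbb R^{n_\rho})^N$ and $c\ge0$ be such that $g(\eta)\in\mathcal P^N$ whenever $\|\eta-\eta_*\|\le c$. A trajectory consists of a locally absolutely continuous $\eta$ and of $u,e,y\in\mathcal L_{2e}[0,\infty)$ (square integrable on $[0,T]$ for every finite $T$) with $$\dot\eta=\hat A_G(\rho)\eta+\hat B_G(\rho)u+\hat B_G(\rho)e\ \text{ (for a.e. } t\ge0),\qquad y=\hat C_G(\rho)\eta,\quad u=\nabla f(y),\quad \rho=g(\eta)\ \text{ (for all } t\ge 0),\qquad\eta(0)=\eta_0.$$ **Multipliers.** For $k\ge 0$ let $A_k$ be the $k\times k$ matrix with $-1$ on the diagonal and $1$ on the first subdiagonal, and $B_k=(1,0,\dots,0)^T\in\mathbb R^k$. For $\alpha>0$ let $\pi$ be the system with state matrix $A_\nu-2\alpha I$, input matrix $B_\nu$, and as output the scalar input followed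 by the $\nu$ states; let $\pi_{m,L}=\mathrm{diag}(\pi,\pi)\begin{bmatrix}-m&1\\L&-1\end{bmatrix}$ and $\Pi_0=\pi_{m,L}\otimes I_d$. Let $R_\nu=\mathrm{diag}(1/\sqrt{0!},\dots,1/\sqrt{(\nu-1)!})$ and let $(\tilde A,\tilde B,\tilde C,\tilde D)$, with $\tilde A=A_{\nu-1}$ and $\tilde B=B_{\nu-1}$, be the realization of $\frac{1}{(s+1)^{\nu-1}}[1\ s\ \cdots\ s^{\nu-1}]^T$. The set $\mathbb P$ consists of the matrices $$P=\begin{bmatrix}0&Q\\Q^T&0\end{bmatrix},\qquad Q=\begin{bmatrix}H&-P_3\\-P_1^T&0\end{bmatrix},$$ with $H\in\mathbb R$ and row vectors $P_1,P_3\in\mathbb R^{1\times\nu}$, such that $H+(P_1+P_3)A_\nu^{-1}B_\nu\ge0$ and, for $i=1,3$, there is a symmetric $\mathcal X_i\in\mathbb R^{(\nu-1)\times(\nu-1)}$ with $$\begin{bmatrix}I&0\\\tilde A&\tilde B\\R_\nu\tilde C&R_\nu\tilde D\end{bmatrix}^T\begin{bmatrix}0&\mathcal X_i&0\\\mathcal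 X_i&0&0\\0&0&\mathrm{diag}(P_i)\end{bmatrix}\begin{bmatrix}I&0\\\tilde A&\tilde B\\R_\nu\tilde C&R_\nu\tilde D\end{bmatrix}\succ0.$$ For $\tilde\rho\in\mathcal P$ let $(\mathcal A_0,\mathcal B_0,\mathcal C_{10},\mathcal D_{10})(\tilde\rho)$ be the state-space matrices of the series connection of the system $\dot\eta_1=A_G(\tilde\rho)\eta_1+B_G(\tilde\rho)(u_1+e_1)$ with output $(C_G(\tilde\rho)\eta_1,u_1)$, followed by $\Pi_0$; its state is that of the plant followed by that of $\Pi_0$ and its input is $(u_1,e_1)$. Let $\mathcal C_{20}=0$, $\mathcal D_{20}=\begin{bmatrix}0&I_d\\I_d&0\end{bmatrix}$. Let $\delta\ge0$ and $M=\mathrm{diag}(-1,\delta^2)$. **Theorem.** Suppose that there are $\mathcal X_0\succ0$, $P\in\mathbb P$, $\lambda\ge0$ and $\alpha>0$ such that for all $\tilde\rho\in\mathcal P$ (arguments $\tilde\rho$ omitted) $$\begin{bmatrix}\mathcal A_0^T\mathcal X_0+\mathcal X_0\mathcal A_0+2\alpha\mathcal X_0&\mathcal X_0\mathcal B_0\\\mathcal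 B_0^T\mathcal X_0&0\end{bmatrix}+\begin{bmatrix}\mathcal C_{10}&\mathcal D_{10}\\\mathcal C_{20}&\mathcal D_{20}\end{bmatrix}^T\begin{bmatrix}P\otimes I_d&0\\0&\lambda(M\otimes I_d)\end{bmatrix}\begin{bmatrix}\mathcal C_{10}&\mathcal D_{10}\\\mathcal C_{20}&\mathcal D_{20}\end{bmatrix}\preceq0,$$ and let $\mathcal X=I_N\otimes\mathcal X_0$, with $\mathrm{cond}(\mathcal X)=\|\mathcal X\|\,\|\mathcal X^{-1}\|$ in the spectral norm. Then every trajectory with $\|e(t)\|\le\delta\|\nabla f(y(t))\|$ for all $t\ge0$ and $\|\eta_0-\eta_*\|<c/\sqrt{\mathrm{cond}(\mathcal X)}$ satisfies $\|\eta(t)-\eta_*\|<c$ for all $t\ge0$, and there is $\kappa\ge0$ such that $\|y(t)-y_*\|\le\kappa e^{-\alpha t}$ for all $t\ge0$. -/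

import Mathlib

open Matrix MeasureTheory
open scoped Kronecker

noncomputable section

namespace SourceSeeking

/-! ### Norms, function and signal classes -/

/-- Spectral condition number `‖X‖ ‖X⁻¹‖` (operator norms induced by the Euclidean norm). -/
def condNumber {n : Type} [Fintype n] [DecidableEq n] (X : Matrix n n ℝ) : ℝ :=
  ‖Matrix.toEuclideanCLM (𝕜 := ℝ) X‖ * ‖Matrix.toEuclideanCLM (𝕜 := ℝ) X⁻¹‖

/-- The class `𝒮(m, L)`: continuously differentiable functions, strongly convex with parameter
`m` and with gradient of Lipschitz parameter `L`. -/
def SectorClass {ι : Type} [Fintype ι] (m L : ℝ) : Set (EuclideanSpace ℝ ι → ℝ) :=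
  {f | ContDiff ℝ 1 f ∧ ∀ y₁ y₂ : EuclideanSpace ℝ ι,
    m * ‖y₁ - y₂‖ ^ 2 ≤ inner ℝ (gradient f y₁ - gradient f y₂) (y₁ - y₂) ∧
    inner ℝ (gradient f y₁ - gradient f y₂) (y₁ - y₂) ≤ L * ‖y₁ - y₂‖ ^ 2}

/-- The signal class `ℒ₂ₑ[0, ∞)`: square integrable over `[0, T]` for every finite `T`. -/
def L2e {ι : Type} [Fintype ι] (s : ℝ → EuclideanSpace ℝ ι) : Prop :=
  ∀ T : ℝ, 0 ≤ T → MemLp s 2 (volume.restrict (Set.Icc 0 T))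

/-! ### State-space realizations -/

/-- A state-space realization `[A B; C D]` with state, input and output index types `n, p, q`. -/
structure StateSpace (n p q : Type) where
  A : Matrix n n ℝ
  B : Matrix n p ℝ
  C : Matrix q n ℝ
  D : Matrix q p ℝ

/-- The series connection `S₂ S₁` (`S₁` acts first); the state is that of `S₁` followed by that
of `S₂`. -/
def StateSpace.series {n₁ n₂ p r q : Type} [Fintype r]
    (S₂ : StateSpace n₂ r q) (S₁ : StateSpace n₁ p r) : StateSpace (n₁ ⊕ n₂) p q where
  A := Matrix.fromBlocks S₁.A 0 (S₂.B * S₁.C) S₂.A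
  B := Matrix.fromRows S₁.B (S₂.B * S₁.D)
  C := Matrix.fromCols (S₂.D * S₁.C) S₂.C
  D := S₂.D * S₁.D

/-- The realization `[A ⊗ I_d, B ⊗ I_d; C ⊗ I_d, D ⊗ I_d]`. -/
def StateSpace.kronId {n p q : Type} (S : StateSpace n p q) (d : ℕ) :
    StateSpace (n × Fin d) (p × Fin d) (q × Fin d) where
  A := S.A ⊗ₖ (1 : Matrix (Fin d) (Fin d) ℝ)
  B := S.B ⊗ₖ (1 : Matrix (Fin d) (Fin d) ℝ)
  C := S.C ⊗ₖ (1 : Matrix (Fin d) (Fin d) ℝ)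
  D := S.D ⊗ₖ (1 : Matrix (Fin d) (Fin d) ℝ)

/-! ### Zames-Falb multipliers -/

/-- The `ν × ν` matrix with `-1` on the diagonal and `1` on the first subdiagonal. -/
def zfA (ν : ℕ) : Matrix (Fin ν) (Fin ν) ℝ :=
  Matrix.of fun i j => if i = j then -1 else if (i : ℕ) = (j : ℕ) + 1 then 1 else 0

/-- The first canonical unit vector as a column. -/
def zfB (ν : ℕ) : Matrix (Fin ν) Unit ℝ :=
  Matrix.of fun i _ => if (i : ℕ) = 0 then 1 else 0

/-- `A_ν^α = A_ν - 2 α I`. -/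
def zfAα (ν : ℕ) (α : ℝ) : Matrix (Fin ν) (Fin ν) ℝ := zfA ν - (2 * α) • 1

/-- Index type of the output `(w, x)` of the filter `π`: the scalar feed-through of its input,
followed by the `ν` filter states. -/
abbrev PiOut (ν : ℕ) : Type := Unit ⊕ Fin ν

/-- The filter `π_{m,L} = diag(π, π) [-m 1; L -1]`; its two scalar inputs are `y` (index `0`)
and `u` (index `1`). -/
def piML (ν : ℕ) (α m L : ℝ) : StateSpace (Fin ν ⊕ Fin ν) (Fin 2) (PiOut ν ⊕ PiOut ν) where
  A := Matrix.fromBlocks (zfAα ν α) 0 0 (zfAα ν α)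
  B := Matrix.fromRows
    (zfB ν * (Matrix.of fun _ j => ![-m, 1] j : Matrix Unit (Fin 2) ℝ))
    (zfB ν * (Matrix.of fun _ j => ![L, -1] j : Matrix Unit (Fin 2) ℝ))
  C := Matrix.fromBlocks
    (Matrix.fromRows (0 : Matrix Unit (Fin ν) ℝ) 1) 0 0
    (Matrix.fromRows (0 : Matrix Unit (Fin ν) ℝ) 1)
  D := Matrix.fromRows
    (Matrix.fromRows (Matrix.of fun _ j => ![-m, 1] j : Matrix Unit (Fin 2) ℝ) 0)
    (Matrix.fromRows (Matrix.of fun _ j => ![L, -1] j : Matrix Unit (Fin 2) ℝ) 0)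

/-- Output matrix of the realization, with state and input matrices `zfA (ν - 1)` and
`zfB (ν - 1)`, of the column `(s ^ j / (s + 1) ^ (ν - 1))`, `j = 0, …, ν - 1`. -/
def posC (ν : ℕ) : Matrix (Fin ν) (Fin (ν - 1)) ℝ :=
  Matrix.of fun j l =>
    (-1) ^ ((j : ℕ) + (ν - 2 - (l : ℕ))) * (Nat.choose (j : ℕ) (ν - 2 - (l : ℕ)) : ℝ)

/-- Feed-through matrix of the same realization. -/
def posD (ν : ℕ) : Matrix (Fin ν) Unit ℝ :=
  Matrix.of fun j _ => if (j : ℕ) = ν - 1 then 1 else 0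

/-- The stated realization of `s ^ j / (s + 1) ^ (ν - 1)`: the state equation
`s x = Ã x + B̃` has the solution `x_l = (s + 1) ^ (-(l + 1))`, and its output
`C̃ x + D̃` has the entries `s ^ j / (s + 1) ^ (ν - 1)`. -/
theorem pos_realization (ν : ℕ) (hν : 1 ≤ ν) (s : ℂ) (hs : s + 1 ≠ 0) :
    (∀ i : Fin (ν - 1), s * (s + 1)⁻¹ ^ ((i : ℕ) + 1) =
      ∑ l, (zfA (ν - 1) i l : ℂ) * (s + 1)⁻¹ ^ ((l : ℕ) + 1) + (zfB (ν - 1) i () : ℂ)) ∧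
    ∀ j : Fin ν, ∑ l, (posC ν j l : ℂ) * (s + 1)⁻¹ ^ ((l : ℕ) + 1) + (posD ν j () : ℂ) =
      s ^ (j : ℕ) / (s + 1) ^ (ν - 1) := by
  obtain ⟨k, rfl⟩ : ∃ k, ν = k + 1 := ⟨ν - 1, by omega⟩
  constructor
  · intro i
    have hi := i.2
    rcases Nat.eq_zero_or_pos (i : ℕ) with h0 | h0
    · rw [Finset.sum_eq_single i]
      · simp [zfA, zfB, h0]; field_simp; ring
      · intro l _ hl
        have : ¬ (i = l) := fun h => hl h.symm
        simp [zfA, this, h0]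
      · simp
    · let i' : Fin (k + 1 - 1) := ⟨(i : ℕ) - 1, by omega⟩
      have hne : i ≠ i' := by
        intro h; have := congrArg Fin.val h; simp [i'] at this; omega
      have hv : (i : ℕ) = (i' : ℕ) + 1 := by simp [i']; omega
      rw [Finset.sum_eq_add i i' hne]
      · have h1 : zfA (k + 1 - 1) i i = -1 := by simp [zfA]
        have h2 : zfA (k + 1 - 1) i i' = 1 := by simp [zfA, hne, hv]
        have h3 : zfB (k + 1 - 1) i () = 0 := by simp [zfB]; omega
        rw [h1, h2, h3, hv]
        push_cast
        simp only [inv_pow, pow_succ]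
        field_simp
        ring
      · rintro l _ ⟨hl, hl'⟩
        have h1 : ¬ (i = l) := fun h => hl h.symm
        have h2 : ¬ ((i : ℕ) = (l : ℕ) + 1) := by
          intro h; apply hl'; ext; simp [i']; omega
        simp [zfA, h1, h2]
      · simp
      · simp
  · intro j
    have key : s ^ (j : ℕ) = ∑ i ∈ Finset.range (k + 1),
        (s + 1) ^ i * (-1) ^ ((j : ℕ) + i) * (Nat.choose (j : ℕ) i : ℂ) := by
      have hj : (j : ℕ) + 1 ≤ k + 1 := j.2
      have : s = (s + 1) + (-1) := by ring
      conv_lhs => rw [this, add_pow]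
      rw [← Finset.sum_subset (Finset.range_mono hj)]
      · refine Finset.sum_congr rfl fun i hi => ?_
        have : (j : ℕ) + i = ((j : ℕ) - i) + 2 * i := by
          have := Finset.mem_range.1 hi; omega
        rw [this, pow_add (-1 : ℂ), pow_mul]; simp
      · intro i _ hi
        have : (j : ℕ) < i := by simpa using hi
        simp [Nat.choose_eq_zero_of_lt this]
    rw [key, Finset.sum_range_succ, add_div, Finset.sum_div, ← Finset.sum_range_reflect]
    have hf : ∀ l : Fin k, (posC (k + 1) j l : ℂ) * (s + 1)⁻¹ ^ ((l : ℕ) + 1) =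
        (s + 1) ^ (k - 1 - (l : ℕ)) * (-1) ^ ((j : ℕ) + (k - 1 - (l : ℕ))) *
          (Nat.choose (j : ℕ) (k - 1 - (l : ℕ)) : ℂ) / (s + 1) ^ (k + 1 - 1) := by
      intro l
      have hl := l.2
      have hk : k + 1 - 1 = (k - 1 - (l : ℕ)) + ((l : ℕ) + 1) := by omega
      have hk2 : k + 1 - 2 - (l : ℕ) = k - 1 - (l : ℕ) := by omega
      rw [hk, pow_add, inv_pow]
      simp only [posC, Matrix.of_apply, hk2]
      push_cast
      field_simp
      ring
    congr 1
    · rw [Finset.sum_range (n := k)]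
      exact Finset.sum_congr rfl fun l _ => hf l
    · by_cases h : (j : ℕ) = k
      · simp [posD, h, ← two_mul, hs]
      · have : (j : ℕ) < k := by have := j.2; omega
        simp [posD, h, Nat.choose_eq_zero_of_lt this]

/-- `R_ν = diag(1 / √0!, …, 1 / √(ν - 1)!)`. -/
def posR (ν : ℕ) : Matrix (Fin ν) (Fin ν) ℝ :=
  Matrix.diagonal fun j => 1 / Real.sqrt (Nat.factorial (j : ℕ))

/-- The outer factor `[I 0; Ã B̃; R C̃ R D̃]` of the positivity LMI. -/
def posOuter (ν : ℕ) :
    Matrix ((Fin (ν - 1) ⊕ Fin (ν - 1)) ⊕ Fin ν) (Fin (ν - 1) ⊕ Unit) ℝ :=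
  Matrix.fromRows
    (Matrix.fromBlocks 1 0 (zfA (ν - 1)) (zfB (ν - 1)))
    (Matrix.fromCols (posR ν * posC ν) (posR ν * posD ν))

/-- The positivity LMI in the variables `X = Xᵀ` and `p`. -/
def PosLMI (ν : ℕ) (X : Matrix (Fin (ν - 1)) (Fin (ν - 1)) ℝ) (p : Fin ν → ℝ) : Prop :=
  ((posOuter ν)ᵀ *
    Matrix.fromBlocks (Matrix.fromBlocks 0 X X 0) 0 0 (Matrix.diagonal p) *
    posOuter ν).PosDef

/-- The matrix of the multiplier class with parameters `H`, `P₁`, `P₃`. -/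
def zfMatrix (ν : ℕ) (H : ℝ) (P₁ P₃ : Fin ν → ℝ) :
    Matrix (PiOut ν ⊕ PiOut ν) (PiOut ν ⊕ PiOut ν) ℝ :=
  let Q : Matrix (PiOut ν) (PiOut ν) ℝ :=
    Matrix.fromBlocks (Matrix.of fun _ _ => H) (Matrix.of fun _ j => -P₃ j)
      (Matrix.of fun i _ => -P₁ i) 0
  Matrix.fromBlocks 0 Q Qᵀ 0

/-- The set `ℙ` of multiplier matrices. -/
def ZFSet (ν : ℕ) : Set (Matrix (PiOut ν ⊕ PiOut ν) (PiOut ν ⊕ PiOut ν) ℝ) :=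
  {P | ∃ (H : ℝ) (P₁ P₃ : Fin ν → ℝ) (X₁ X₃ : Matrix (Fin (ν - 1)) (Fin (ν - 1)) ℝ),
    X₁.IsSymm ∧ X₃.IsSymm ∧
    0 ≤ H + ∑ i, (P₁ i + P₃ i) * ((zfA ν)⁻¹ * zfB ν) i () ∧
    PosLMI ν X₁ P₁ ∧ PosLMI ν X₃ P₃ ∧
    P = zfMatrix ν H P₁ P₃}

/-! ### Vehicle models and their stacking -/

/-- Parameter-dependent closed-loop vehicle dynamics
`ẋ = A(ρ) x + B_q(ρ) q + B_p(ρ) p`, `y = C(ρ) x` together with the gains `k_d`, `k_p` of the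
augmentation `q̇ = p`, `ṗ = -k_d p - k_p u`. -/
structure Vehicle (nx d nρ : ℕ) where
  A : EuclideanSpace ℝ (Fin nρ) → Matrix (Fin nx) (Fin nx) ℝ
  Bq : EuclideanSpace ℝ (Fin nρ) → Matrix (Fin nx) (Fin d) ℝ
  Bp : EuclideanSpace ℝ (Fin nρ) → Matrix (Fin nx) (Fin d) ℝ
  C : EuclideanSpace ℝ (Fin nρ) → Matrix (Fin d) (Fin nx) ℝ
  kd : ℝ
  kp : ℝ

/-- Index type of the state `(x, q, p)` of one agent. -/
abbrev AgentState (nx d : ℕ) : Type := Fin nx ⊕ (Fin d ⊕ Fin d)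

variable {nx d nρ : ℕ}

def Vehicle.AG (G : Vehicle nx d nρ) (ρ : EuclideanSpace ℝ (Fin nρ)) :
    Matrix (AgentState nx d) (AgentState nx d) ℝ :=
  Matrix.fromBlocks (G.A ρ) (Matrix.fromCols (G.Bq ρ) (G.Bp ρ))
    0 (Matrix.fromBlocks 0 1 0 (-(G.kd • 1)))

def Vehicle.BG (G : Vehicle nx d nρ) (_ρ : EuclideanSpace ℝ (Fin nρ)) :
    Matrix (AgentState nx d) (Fin d) ℝ :=
  Matrix.fromRows 0 (Matrix.fromRows 0 (-(G.kp • 1)))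

def Vehicle.CG (G : Vehicle nx d nρ) (ρ : EuclideanSpace ℝ (Fin nρ)) :
    Matrix (Fin d) (AgentState nx d) ℝ :=
  Matrix.fromCols (G.C ρ) 0

/-- `blkdiag(M₁, …, M_N)`. -/
def blkdiag {N : ℕ} {r s : Type} (M : Fin N → Matrix r s ℝ) :
    Matrix (Fin N × r) (Fin N × s) ℝ :=
  Matrix.of fun a b => if a.1 = b.1 then M a.1 a.2 b.2 else 0

/-! ### The single-agent LMI -/

/-- The plant of one agent with inputs `(u, e)` and outputs `(y, u)`, the latter two having the
indices `0` and `1`. -/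
def Vehicle.extended (G : Vehicle nx d nρ) (ρ : EuclideanSpace ℝ (Fin nρ)) :
    StateSpace (AgentState nx d) (Fin d ⊕ Fin d) (Fin 2 × Fin d) where
  A := G.AG ρ
  B := Matrix.fromCols (G.BG ρ) (G.BG ρ)
  C := Matrix.of fun k j => if k.1 = 0 then G.CG ρ k.2 j else 0
  D := Matrix.of fun k j => if k.1 = 0 then 0 else
    Matrix.fromCols (1 : Matrix (Fin d) (Fin d) ℝ) (0 : Matrix (Fin d) (Fin d) ℝ) k.2 j

/-- The system `[𝒜₀ ℬ₀; 𝒞₁₀ 𝒟₁₀]`: the plant of one agent followed by `Π₀ = π_{m,L} ⊗ I_d`. -/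
def Vehicle.filtered (G : Vehicle nx d nρ) (ν : ℕ) (α m L : ℝ)
    (ρ : EuclideanSpace ℝ (Fin nρ)) :
    StateSpace (AgentState nx d ⊕ (Fin ν ⊕ Fin ν) × Fin d) (Fin d ⊕ Fin d)
      ((PiOut ν ⊕ PiOut ν) × Fin d) :=
  ((piML ν α m L).kronId d).series (G.extended ρ)

/-- The matrix `𝒟₂₀`, mapping the inputs `(u, e)` to the pair `(e, u)` (indices `0` and `1`). -/
def noiseD (d : ℕ) : Matrix (Fin 2 × Fin d) (Fin d ⊕ Fin d) ℝ :=
  Matrix.of fun k j => if k.1 = 0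
    then Matrix.fromCols (0 : Matrix (Fin d) (Fin d) ℝ) (1 : Matrix (Fin d) (Fin d) ℝ) k.2 j
    else Matrix.fromCols (1 : Matrix (Fin d) (Fin d) ℝ) (0 : Matrix (Fin d) (Fin d) ℝ) k.2 j

/-- `M = diag(-1, δ²)`. -/
def noiseM (δ : ℝ) : Matrix (Fin 2) (Fin 2) ℝ := !![-1, 0; 0, δ ^ 2]

/-- The left-hand side of the single-agent LMI. -/
def Vehicle.lmi (G : Vehicle nx d nρ) (ν : ℕ) (α m L δ lam : ℝ)
    (X₀ : Matrix (AgentState nx d ⊕ (Fin ν ⊕ Fin ν) × Fin d)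
      (AgentState nx d ⊕ (Fin ν ⊕ Fin ν) × Fin d) ℝ)
    (P : Matrix (PiOut ν ⊕ PiOut ν) (PiOut ν ⊕ PiOut ν) ℝ)
    (ρ : EuclideanSpace ℝ (Fin nρ)) :
    Matrix ((AgentState nx d ⊕ (Fin ν ⊕ Fin ν) × Fin d) ⊕ (Fin d ⊕ Fin d))
      ((AgentState nx d ⊕ (Fin ν ⊕ Fin ν) × Fin d) ⊕ (Fin d ⊕ Fin d)) ℝ :=
  let S := G.filtered ν α m L ρ
  let W := Matrix.fromBlocks S.C S.D 0 (noiseD d)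
  Matrix.fromBlocks (S.Aᵀ * X₀ + X₀ * S.A + (2 * α) • X₀) (X₀ * S.B) (S.Bᵀ * X₀) 0 +
    Wᵀ * Matrix.fromBlocks (P ⊗ₖ (1 : Matrix (Fin d) (Fin d) ℝ)) 0 0
      (lam • (noiseM δ ⊗ₖ (1 : Matrix (Fin d) (Fin d) ℝ))) * W

/-! ### Equilibria and trajectories of the network -/

/-- `(η_*, y_*)` is an equilibrium with zero inputs of the network for all parameter values, and
`y_*` minimizes `f`. -/
structure IsEquilibrium {N : ℕ} (G : Vehicle nx d nρ) (Ps : Set (EuclideanSpace ℝ (Fin nρ)))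
    (f : EuclideanSpace ℝ (Fin N × Fin d) → ℝ)
    (ηs : EuclideanSpace ℝ (Fin N × AgentState nx d))
    (ys : EuclideanSpace ℝ (Fin N × Fin d)) : Prop where
  state : ∀ ρ : Fin N → EuclideanSpace ℝ (Fin nρ), (∀ i, ρ i ∈ Ps) →
    blkdiag (fun i => G.AG (ρ i)) *ᵥ ηs.ofLp = 0
  output : ∀ ρ : Fin N → EuclideanSpace ℝ (Fin nρ), (∀ i, ρ i ∈ Ps) →
    ys.ofLp = blkdiag (fun i => G.CG (ρ i)) *ᵥ ηs.ofLp
  minimizer : ∀ z, f ys ≤ f z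

/-- `(η, u, e, y, ρ)` is a solution on `[0, ∞)` of the quasi-LPV network dynamics
`η̇ = Â_G(ρ) η + B̂_G(ρ) u + B̂_G(ρ) e`, `y = Ĉ_G(ρ) η`, `u = ∇f(y)`, `ρ = g(η)`, `η(0) = η₀`
in the sense of Carathéodory: the state is locally absolutely continuous and satisfies the
differential equation almost everywhere. -/
structure IsTrajectory {N : ℕ} (G : Vehicle nx d nρ)
    (g : EuclideanSpace ℝ (Fin N × AgentState nx d) → Fin N → EuclideanSpace ℝ (Fin nρ))
    (f : EuclideanSpace ℝ (Fin N × Fin d) → ℝ)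
    (η₀ : EuclideanSpace ℝ (Fin N × AgentState nx d))
    (η : ℝ → EuclideanSpace ℝ (Fin N × AgentState nx d))
    (u e y : ℝ → EuclideanSpace ℝ (Fin N × Fin d))
    (ρ : ℝ → Fin N → EuclideanSpace ℝ (Fin nρ)) : Prop where
  absCont : ∀ T : ℝ, 0 ≤ T → AbsolutelyContinuousOnInterval η 0 T
  u_mem : L2e u
  e_mem : L2e e
  y_mem : L2e y
  init : η 0 = η₀
  dynamics : ∀ᵐ t ∂(volume.restrict (Set.Ici (0 : ℝ))),
    HasDerivAt η (WithLp.toLp 2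
      (blkdiag (fun i => G.AG (ρ t i)) *ᵥ (η t).ofLp +
        blkdiag (fun i => G.BG (ρ t i)) *ᵥ (u t).ofLp +
        blkdiag (fun i => G.BG (ρ t i)) *ᵥ (e t).ofLp)) t
  output : ∀ t : ℝ, 0 ≤ t → (y t).ofLp = blkdiag (fun i => G.CG (ρ t i)) *ᵥ (η t).ofLp
  input : ∀ t : ℝ, 0 ≤ t → u t = gradient f (y t)
  scheduling : ∀ t : ℝ, 0 ≤ t → ρ t = g (η t)

/-- The noise bound `‖e(t)‖ ≤ δ ‖∇f(y(t))‖` for all `t ≥ 0`. -/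
def NoiseBound {ι : Type} [Fintype ι] (δ : ℝ) (f : EuclideanSpace ℝ ι → ℝ)
    (e y : ℝ → EuclideanSpace ℝ ι) : Prop :=
  ∀ t : ℝ, 0 ≤ t → ‖e t‖ ≤ δ * ‖gradient f (y t)‖

end SourceSeeking

end

/-!
The proof is a dissipativity argument with a dynamic Zames-Falb multiplier. Let
`q = ∇f(y) - m (y - y_*)` and `r = L (y - y_*) - ∇f(y)` be the two sector signals, which drive the
filters in the linear matrix inequality (LMI), and let `V` be the quadratic form of `I_N ⊗ X₀` in
the states of plant and filters.

Evaluated along a trajectory, and with the `λ` term dropped because the noise bound makes it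
nonnegative, the LMI says that `e^{2αt} V` has derivative at most
`-2 e^{2αt} σ`, where the supply `σ` is `H ⟨q, r⟩` minus the correlations of `r` with the `P₁`
filtered `q` and of `q` with the `P₃` filtered `r` (`lmi_dissipation`, `network_dissipation`).
It remains to see that `e^{2αt} σ` has nonnegative integrals over `[0, T]`:

* The positivity LMIs make the impulse responses `e^{-t} ∑ p_j t ^ j / j!` nonnegative
  (`posLMI_polynomial_nonneg`), and the condition on `H` says that `H` is at least the sum of their
  integrals (`zfA_inv_mul_zfB`).
* By cocoercivity of the gradient, there are potentials `ψ ≥ 0` of the output with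
  `⟨r(t), q(t) - q(s)⟩ ≥ ψ(t) - ψ(s)`, and similarly with `q` and `r` exchanged
  (`lowPotential_sub_le`, `upPotential_sub_le`). Averaging over the past with the nonnegative
  impulse response gives at every time a lower bound for `σ`, in which the signals are replaced by
  the scalar `ψ` (`zamesFalb_pointwise`).
* After multiplication by `e^{2αt}` this lower bound is the derivative of a storage function that
  starts at zero and is a convolution of `e^{2αt} ψ` with the nonnegative tail integrals of the
  impulse response, hence nonnegative (`zfStorage_ae_hasDerivAt`, `zfStorage_nonneg`).

So `e^{2αT} V(T) ≤ V(0)` as long as the scheduling parameters stay in the set where the LMI holds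
(`energy_decay`). Since the filters start at zero, the state deviation decays up to the condition
number of `I_N ⊗ X₀`; at a first exit time from the ball of radius `c` this is a contradiction, so
the estimate holds for all times.

The state is only absolutely continuous and the signals are only square integrable; the
fundamental theorem of calculus for absolutely continuous functions turns almost everywhere inequalities for derivatives into inequalities for values.
-/

open Matrix MeasureTheory
open scoped Kronecker

noncomputable section

namespace SourceSeeking

/-! ### Interpolation inequalities for functions in the sector class -/

section Sector

variable {ι : Type} [Fintype ι] {m L : ℝ} {f : EuclideanSpace ℝ ι → ℝ}

/-- If the gradient of `f` grows along `w - x` at least at rate `k`, then `f` lies above its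
quadratic model with curvature `k` at `x`. -/
theorem quadratic_lower_bound {k : ℝ} (hf : ContDiff ℝ 1 f)
    (h : ∀ y₁ y₂ : EuclideanSpace ℝ ι,
      k * ‖y₁ - y₂‖ ^ 2 ≤ inner ℝ (gradient f y₁ - gradient f y₂) (y₁ - y₂))
    (x w : EuclideanSpace ℝ ι) :
    f x + inner ℝ (gradient f x) (w - x) + k / 2 * ‖w - x‖ ^ 2 ≤ f w := by
  have hdiff : Differentiable ℝ f := hf.differentiable (by norm_num)
  let φ : ℝ → ℝ := fun s => f (x + s • (w - x)) - s * inner ℝ (gradient f x) (w - x)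
    - s ^ 2 * (k / 2 * ‖w - x‖ ^ 2)
  have hder : ∀ s, HasDerivAt φ (inner ℝ (gradient f (x + s • (w - x))) (w - x)
      - inner ℝ (gradient f x) (w - x) - 2 * s * (k / 2 * ‖w - x‖ ^ 2)) s := by
    intro s
    have h1 : HasDerivAt (fun s : ℝ => x + s • (w - x)) (w - x) s := by
      simpa using ((hasDerivAt_id s).smul_const (w - x)).const_add x
    have h2 := ((hdiff (x + s • (w - x))).hasGradientAt.hasFDerivAt).comp_hasDerivAt s h1
    have h3 := (hasDerivAt_id s).mul_const (inner ℝ (gradient f x) (w - x))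
    have h4 := ((hasDerivAt_id s).pow 2).mul_const (k / 2 * ‖w - x‖ ^ 2)
    refine ((h2.sub h3).sub h4).congr_deriv ?_
    simp
  have hmono : MonotoneOn φ (Set.Icc 0 1) := by
    refine monotoneOn_of_deriv_nonneg (convex_Icc 0 1)
      (fun s _ => (hder s).continuousAt.continuousWithinAt)
      (fun s _ => (hder s).differentiableAt.differentiableWithinAt) fun s hs => ?_
    rw [interior_Icc] at hs
    rw [(hder s).deriv]
    have := h (x + s • (w - x)) x
    rw [add_sub_cancel_left, inner_smul_right, norm_smul, Real.norm_of_nonneg hs.1.le,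
      inner_sub_left] at this
    have h5 : s * (k * s * ‖w - x‖ ^ 2) ≤ s * (inner ℝ (gradient f (x + s • (w - x))) (w - x)
      - inner ℝ (gradient f x) (w - x)) := by linarith
    have := le_of_mul_le_mul_left h5 hs.1
    linarith
  have := hmono (Set.left_mem_Icc.2 zero_le_one) (Set.right_mem_Icc.2 zero_le_one) zero_le_one
  simp only [φ, one_smul, zero_smul, add_zero, add_sub_cancel] at this
  linarith

theorem quadratic_upper_bound {k : ℝ} (hf : ContDiff ℝ 1 f)
    (h : ∀ y₁ y₂ : EuclideanSpace ℝ ι,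
      inner ℝ (gradient f y₁ - gradient f y₂) (y₁ - y₂) ≤ k * ‖y₁ - y₂‖ ^ 2)
    (x w : EuclideanSpace ℝ ι) :
    f w ≤ f x + inner ℝ (gradient f x) (w - x) + k / 2 * ‖w - x‖ ^ 2 := by
  have hgrad : ∀ z, gradient (fun y => -f y) z = -gradient f z := by
    intro z
    rw [gradient, fderiv_fun_neg, map_neg, gradient]
  have := quadratic_lower_bound (f := fun y => -f y) (k := -k) hf.neg (fun y₁ y₂ => by
    rw [hgrad, hgrad, ← neg_sub', inner_neg_left]
    linarith [h y₁ y₂]) x w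
  rw [hgrad, inner_neg_left] at this
  linarith

/-- Cocoercivity: after the curvature `m` is split off, the Bregman distance dominates the squared
difference of gradients. The form without division also covers `m = L`. -/
theorem bregman_lower_bound (hmL : m ≤ L) (hf : f ∈ SectorClass m L)
    (x z : EuclideanSpace ℝ ι) :
    1 / 2 * ‖gradient f x - gradient f z - m • (x - z)‖ ^ 2 ≤
      (L - m) * (f x - f z - inner ℝ (gradient f z) (x - z) - m / 2 * ‖x - z‖ ^ 2) := by
  set Δ := gradient f x - gradient f z - m • (x - z) with hΔ
  set D := f x - f z - inner ℝ (gradient f z) (x - z) - m / 2 * ‖x - z‖ ^ 2 with hD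
  have key : ∀ s : ℝ, (s - (L - m) * s ^ 2 / 2) * ‖Δ‖ ^ 2 ≤ D := by
    intro s
    -- compare both quadratic models at the gradient step `w = x - s Δ`
    have h1 := quadratic_lower_bound hf.1 (fun a b => (hf.2 a b).1) z (x - s • Δ)
    have h2 := quadratic_upper_bound hf.1 (fun a b => (hf.2 a b).2) x (x - s • Δ)
    have e1 : x - s • Δ - z = (x - z) - s • Δ := by abel
    have e2 : x - s • Δ - x = -(s • Δ) := by abel
    rw [e1, norm_sub_sq_real, inner_sub_right, inner_smul_right, inner_smul_right, norm_smul,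
      mul_pow, Real.norm_eq_abs, sq_abs] at h1
    rw [e2, norm_neg, norm_smul, mul_pow, Real.norm_eq_abs, sq_abs, inner_neg_right,
      inner_smul_right] at h2
    have h3 : ‖Δ‖ ^ 2 = inner ℝ (gradient f x) Δ - inner ℝ (gradient f z) Δ
        - m * inner ℝ (x - z) Δ := by
      rw [← real_inner_self_eq_norm_sq]
      conv_lhs => rw [hΔ, ← hΔ]
      nth_rewrite 1 [hΔ]
      rw [inner_sub_left, inner_sub_left, inner_smul_left]
      rfl
    have h4 : s * ‖Δ‖ ^ 2 = s * (inner ℝ (gradient f x) Δ - inner ℝ (gradient f z) Δ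
        - m * inner ℝ (x - z) Δ) := by rw [← h3]
    rw [hD]
    linarith
  rcases hmL.eq_or_lt with h | h
  · subst h
    have hD0 : 0 ≤ D := by simpa using key 0
    have := key ((D + 1) / ‖Δ‖ ^ 2)
    by_cases h0 : ‖Δ‖ ^ 2 = 0
    · simp [h0]
    · rw [sub_self, zero_mul, zero_div, sub_zero, div_mul_cancel₀ _ h0] at this
      linarith
  · have h0 : 0 < L - m := by linarith
    have := mul_le_mul_of_nonneg_left (key (1 / (L - m))) h0.le
    have e : (L - m) * ((1 / (L - m) - (L - m) * (1 / (L - m)) ^ 2 / 2) * ‖Δ‖ ^ 2) =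
        1 / 2 * ‖Δ‖ ^ 2 := by
      field_simp; ring
    linarith

/-- The lower sector signal `∇f(x) - m (x - y_*)`. -/
def sectorLow (f : EuclideanSpace ℝ ι → ℝ) (m : ℝ) (ys x : EuclideanSpace ℝ ι) :
    EuclideanSpace ℝ ι := gradient f x - m • (x - ys)

/-- The upper sector signal `L (x - y_*) - ∇f(x)`. -/
def sectorUp (f : EuclideanSpace ℝ ι → ℝ) (L : ℝ) (ys x : EuclideanSpace ℝ ι) :
    EuclideanSpace ℝ ι := L • (x - ys) - gradient f x

/-- `f` without its curvature `m`, normalized to vanish at `y_*`. -/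
def sectorGap (f : EuclideanSpace ℝ ι → ℝ) (m : ℝ) (ys x : EuclideanSpace ℝ ι) : ℝ :=
  f x - f ys - m / 2 * ‖x - ys‖ ^ 2

/-- The potential whose differences bound the correlation of `sectorUp` with differences of
`sectorLow`: it equals `⟨sectorUp, sectorLow⟩ - upPotential`, the Legendre transform of
`upPotential`. -/
def lowPotential (f : EuclideanSpace ℝ ι → ℝ) (m L : ℝ) (ys x : EuclideanSpace ℝ ι) : ℝ :=
  (L - m) * (inner ℝ (sectorLow f m ys x) (x - ys) - sectorGap f m ys x)
    - 1 / 2 * ‖sectorLow f m ys x‖ ^ 2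

/-- The potential whose differences bound the correlation of `sectorLow` with differences of
`sectorUp`: as a function of `sectorUp` it has the gradient `sectorLow`. -/
def upPotential (f : EuclideanSpace ℝ ι → ℝ) (m L : ℝ) (ys x : EuclideanSpace ℝ ι) : ℝ :=
  (L - m) * sectorGap f m ys x - 1 / 2 * ‖sectorLow f m ys x‖ ^ 2

/-- `bregman_lower_bound` in terms of the normalized function and its gradient. -/
theorem sectorGap_bregman (hmL : m ≤ L) (hf : f ∈ SectorClass m L)
    (ys x z : EuclideanSpace ℝ ι) :
    1 / 2 * ‖sectorLow f m ys x - sectorLow f m ys z‖ ^ 2 ≤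
      (L - m) * (sectorGap f m ys x - sectorGap f m ys z
        - (inner ℝ (sectorLow f m ys z) (x - ys) - inner ℝ (sectorLow f m ys z) (z - ys))) := by
  have h := bregman_lower_bound hmL hf x z
  have e1 : sectorLow f m ys x - sectorLow f m ys z =
      gradient f x - gradient f z - m • (x - z) := by
    simp only [sectorLow, smul_sub]; abel
  have e2 : x - z = (x - ys) - (z - ys) := by abel
  rw [e1]
  refine h.trans_eq ?_
  rw [e2, sectorGap, sectorGap, sectorLow]
  generalize x - ys = a
  generalize z - ys = b
  rw [norm_sub_sq_real, inner_sub_right, inner_sub_left, inner_sub_left, inner_smul_left,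
    inner_smul_left, real_inner_self_eq_norm_sq, real_inner_comm a b, conj_trivial]
  ring

theorem sectorUp_eq (ys x : EuclideanSpace ℝ ι) :
    sectorUp f L ys x = (L - m) • (x - ys) - sectorLow f m ys x := by
  simp only [sectorUp, sectorLow, sub_smul]; abel

theorem lowPotential_sub_le (hmL : m ≤ L) (hf : f ∈ SectorClass m L)
    (ys x z : EuclideanSpace ℝ ι) :
    lowPotential f m L ys x - lowPotential f m L ys z ≤
      inner ℝ (sectorUp f L ys x) (sectorLow f m ys x - sectorLow f m ys z) := by
  have h := sectorGap_bregman hmL hf ys x z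
  rw [norm_sub_sq_real] at h
  rw [sectorUp_eq (m := m), inner_sub_right, inner_sub_left, inner_sub_left, inner_smul_left,
    inner_smul_left, real_inner_self_eq_norm_sq, lowPotential, lowPotential,
    real_inner_comm, real_inner_comm (sectorLow f m ys z)]
  simp only [conj_trivial]
  linarith

theorem upPotential_sub_le (hmL : m ≤ L) (hf : f ∈ SectorClass m L)
    (ys x z : EuclideanSpace ℝ ι) :
    upPotential f m L ys x - upPotential f m L ys z ≤
      inner ℝ (sectorLow f m ys x) (sectorUp f L ys x - sectorUp f L ys z) := by
  have h := sectorGap_bregman hmL hf ys z x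
  rw [norm_sub_sq_real] at h
  rw [sectorUp_eq (m := m), sectorUp_eq (m := m), inner_sub_right, inner_sub_right,
    inner_sub_right, inner_smul_right,
    inner_smul_right, real_inner_self_eq_norm_sq, upPotential, upPotential,
    real_inner_comm (sectorLow f m ys z)]
  linarith

variable {ys : EuclideanSpace ℝ ι}

theorem gradient_minimizer (hmin : ∀ z, f ys ≤ f z) : gradient f ys = 0 := by
  have : IsLocalMin f ys := Filter.Eventually.of_forall hmin
  rw [gradient, this.fderiv_eq_zero, map_zero]

theorem sectorLow_self (h0 : gradient f ys = 0) : sectorLow f m ys ys = 0 := by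
  simp [sectorLow, h0]

theorem sectorUp_self (h0 : gradient f ys = 0) : sectorUp f L ys ys = 0 := by
  simp [sectorUp, h0]

theorem lowPotential_self (h0 : gradient f ys = 0) : lowPotential f m L ys ys = 0 := by
  simp [lowPotential, sectorLow_self h0, sectorGap]

theorem upPotential_self (h0 : gradient f ys = 0) : upPotential f m L ys ys = 0 := by
  simp [upPotential, sectorLow_self h0, sectorGap]

theorem lowPotential_nonneg (hmL : m ≤ L) (hf : f ∈ SectorClass m L)
    (h0 : gradient f ys = 0) (x : EuclideanSpace ℝ ι) : 0 ≤ lowPotential f m L ys x := by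
  have := lowPotential_sub_le hmL hf ys ys x
  rw [lowPotential_self h0, sectorUp_self h0, inner_zero_left] at this
  linarith

theorem upPotential_nonneg (hmL : m ≤ L) (hf : f ∈ SectorClass m L)
    (h0 : gradient f ys = 0) (x : EuclideanSpace ℝ ι) : 0 ≤ upPotential f m L ys x := by
  have := upPotential_sub_le hmL hf ys ys x
  rw [upPotential_self h0, sectorLow_self h0, inner_zero_left] at this
  linarith

theorem lowPotential_le (hmL : m ≤ L) (hf : f ∈ SectorClass m L)
    (h0 : gradient f ys = 0) (x : EuclideanSpace ℝ ι) :
    lowPotential f m L ys x ≤ inner ℝ (sectorUp f L ys x) (sectorLow f m ys x) := by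
  have := lowPotential_sub_le hmL hf ys x ys
  rwa [lowPotential_self h0, sectorLow_self h0, sub_zero, sub_zero] at this

theorem upPotential_le (hmL : m ≤ L) (hf : f ∈ SectorClass m L)
    (h0 : gradient f ys = 0) (x : EuclideanSpace ℝ ι) :
    upPotential f m L ys x ≤ inner ℝ (sectorLow f m ys x) (sectorUp f L ys x) := by
  have := upPotential_sub_le hmL hf ys x ys
  rwa [upPotential_self h0, sectorUp_self h0, sub_zero, sub_zero] at this

theorem continuous_gradient (hf : f ∈ SectorClass m L) : Continuous (gradient f) := by
  have := hf.1.continuous_fderiv (by norm_num)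
  exact (InnerProductSpace.toDual ℝ _).symm.continuous.comp this

theorem continuous_sectorLow (hf : f ∈ SectorClass m L) : Continuous (sectorLow f m ys) :=
  (continuous_gradient hf).sub ((continuous_id.sub continuous_const).const_smul m)

theorem continuous_sectorGap (hf : f ∈ SectorClass m L) : Continuous (sectorGap f m ys) := by
  have := hf.1.continuous
  unfold sectorGap
  fun_prop

theorem continuous_lowPotential (hf : f ∈ SectorClass m L) :
    Continuous (lowPotential f m L ys) := by
  have h1 := continuous_sectorLow (ys := ys) hf
  have h2 := continuous_sectorGap (ys := ys) hf
  unfold lowPotential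
  fun_prop

theorem continuous_upPotential (hf : f ∈ SectorClass m L) :
    Continuous (upPotential f m L ys) := by
  have h1 := continuous_sectorLow (ys := ys) hf
  have h2 := continuous_sectorGap (ys := ys) hf
  unfold upPotential
  fun_prop

end Sector

/-! ### Positivity of the impulse responses described by the multiplier class -/

/-- The quadratic form of the positivity LMI, evaluated at state `x` and input `c`. -/
theorem posLMI_quadForm {ν : ℕ} {X : Matrix (Fin (ν - 1)) (Fin (ν - 1)) ℝ} {p : Fin ν → ℝ}
    (h : PosLMI ν X p) (x : Fin (ν - 1) → ℝ) (c : ℝ) :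
    0 ≤ x ⬝ᵥ X *ᵥ (zfA (ν - 1) *ᵥ x + zfB (ν - 1) *ᵥ fun _ => c)
      + (zfA (ν - 1) *ᵥ x + zfB (ν - 1) *ᵥ fun _ => c) ⬝ᵥ X *ᵥ x
      + ∑ j, p j * ((posC ν *ᵥ x + posD ν *ᵥ fun _ => c) j ^ 2 / (Nat.factorial (j : ℕ) : ℝ)) := by
  have h1 := h.posSemidef.dotProduct_mulVec_nonneg (Sum.elim x fun _ => c)
  rw [star_trivial, ← mulVec_mulVec, ← mulVec_mulVec, dotProduct_mulVec, vecMul_transpose] at h1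
  have h2 : posOuter ν *ᵥ (Sum.elim x fun _ => c) =
      Sum.elim (Sum.elim x (zfA (ν - 1) *ᵥ x + zfB (ν - 1) *ᵥ fun _ => c))
        (posR ν *ᵥ (posC ν *ᵥ x + posD ν *ᵥ fun _ => c)) := by
    rw [posOuter, fromRows_mulVec, fromBlocks_mulVec, fromCols_mulVec_sumElim, ← mulVec_mulVec,
      ← mulVec_mulVec, ← mulVec_add]
    simp
  rw [h2, fromBlocks_mulVec, fromBlocks_mulVec] at h1
  simp only [Sum.elim_comp_inl, Sum.elim_comp_inr, zero_mulVec, add_zero, zero_add,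
    sumElim_dotProduct_sumElim] at h1
  refine h1.trans_eq ?_
  congr 1
  simp only [dotProduct, posR, mulVec_diagonal]
  refine Finset.sum_congr rfl fun j _ => ?_
  have hj : (0 : ℝ) ≤ (Nat.factorial (j : ℕ) : ℝ) := Nat.cast_nonneg _
  have := Real.sq_sqrt hj
  have hj' : (Nat.factorial (j : ℕ) : ℝ) ≠ 0 := Nat.cast_ne_zero.2 (Nat.factorial_ne_zero _)
  field_simp
  rw [this]
  ring

/-- The positivity LMI, a KYP-type condition, makes the polynomial `∑ p_j s ^ j / j!` nonnegative on
the half line: at the frequency `s = ω²` this is the value of the LMI on the complex state of the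
realization in `pos_realization`, where the terms with `X` cancel. -/
theorem posLMI_polynomial_nonneg {ν : ℕ} (hν : 1 ≤ ν)
    {X : Matrix (Fin (ν - 1)) (Fin (ν - 1)) ℝ} (hX : X.IsSymm) {p : Fin ν → ℝ}
    (h : PosLMI ν X p) {t : ℝ} (ht : 0 ≤ t) :
    0 ≤ ∑ j : Fin ν, p j * (t ^ (j : ℕ) / (Nat.factorial (j : ℕ) : ℝ)) := by
  set ω := Real.sqrt t with hω
  have hω2 : ω * ω = t := Real.mul_self_sqrt ht
  set s : ℂ := ω * Complex.I with hs_def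
  have hs : s + 1 ≠ 0 := by
    intro h0
    have := congrArg Complex.re h0
    simp [s] at this
  obtain ⟨hst, hout⟩ := pos_realization ν hν s hs
  set z : Fin (ν - 1) → ℂ := fun l => (s + 1)⁻¹ ^ ((l : ℕ) + 1) with hz
  set xr : Fin (ν - 1) → ℝ := fun l => (z l).re with hxr
  set xi : Fin (ν - 1) → ℝ := fun l => (z l).im with hxi
  have hr : zfA (ν - 1) *ᵥ xr + zfB (ν - 1) *ᵥ (fun _ => 1) = -(ω • xi) := by
    ext i
    have := congrArg Complex.re (hst i)
    simp only [Complex.add_re, Complex.re_sum, Complex.re_ofReal_mul, Complex.ofReal_re] at this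
    simp only [Pi.add_apply, mulVec, dotProduct, Finset.univ_unique, Finset.sum_singleton,
      Pi.neg_apply, Pi.smul_apply, smul_eq_mul, mul_one]
    refine Eq.trans this.symm ?_
    change (s * z i).re = _
    simp [s, hxi]
  have hi : zfA (ν - 1) *ᵥ xi + zfB (ν - 1) *ᵥ (fun _ => 0) = ω • xr := by
    ext i
    have := congrArg Complex.im (hst i)
    simp only [Complex.add_im, Complex.im_sum, Complex.im_ofReal_mul, Complex.ofReal_im] at this
    simp only [Pi.add_apply, mulVec, dotProduct, Finset.univ_unique, Finset.sum_singleton,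
      Pi.smul_apply, smul_eq_mul, mul_zero]
    refine Eq.trans this.symm ?_
    change (s * z i).im = _
    simp [s, hxr]
  have hor : ∀ j, (posC ν *ᵥ xr + posD ν *ᵥ (fun _ => 1)) j =
      (s ^ (j : ℕ) / (s + 1) ^ (ν - 1)).re := by
    intro j
    have := congrArg Complex.re (hout j)
    simp only [Complex.add_re, Complex.re_sum, Complex.re_ofReal_mul, Complex.ofReal_re] at this
    rw [← this]
    simp [mulVec, dotProduct, hxr, hz]
  have hoi : ∀ j, (posC ν *ᵥ xi + posD ν *ᵥ (fun _ => 0)) j =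
      (s ^ (j : ℕ) / (s + 1) ^ (ν - 1)).im := by
    intro j
    have := congrArg Complex.im (hout j)
    simp only [Complex.add_im, Complex.im_sum, Complex.im_ofReal_mul, Complex.ofReal_im] at this
    rw [← this]
    simp [mulVec, dotProduct, hxi, hz]
  have h1 := posLMI_quadForm h xr 1
  have h2 := posLMI_quadForm h xi 0
  rw [hr] at h1
  rw [hi] at h2
  simp only [hor] at h1
  simp only [hoi] at h2
  have hsym : xi ⬝ᵥ X *ᵥ xr = xr ⬝ᵥ X *ᵥ xi := by
    rw [dotProduct_mulVec, ← mulVec_transpose, hX, dotProduct_comm]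
  simp only [mulVec_neg, mulVec_smul, dotProduct_neg, dotProduct_smul, neg_dotProduct,
    smul_dotProduct, hsym] at h1 h2
  have h3 : 0 ≤ ∑ j : Fin ν, p j * (Complex.normSq (s ^ (j : ℕ) / (s + 1) ^ (ν - 1)) /
      (Nat.factorial (j : ℕ) : ℝ)) := by
    have : ∑ j : Fin ν, p j * (Complex.normSq (s ^ (j : ℕ) / (s + 1) ^ (ν - 1)) /
        (Nat.factorial (j : ℕ) : ℝ)) =
        ∑ j : Fin ν, p j * ((s ^ (j : ℕ) / (s + 1) ^ (ν - 1)).re ^ 2 /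
          (Nat.factorial (j : ℕ) : ℝ)) +
        ∑ j : Fin ν, p j * ((s ^ (j : ℕ) / (s + 1) ^ (ν - 1)).im ^ 2 /
          (Nat.factorial (j : ℕ) : ℝ)) := by
      rw [← Finset.sum_add_distrib]
      refine Finset.sum_congr rfl fun j _ => ?_
      rw [Complex.normSq_apply]
      ring
    rw [this]
    linarith
  have hn : 0 < Complex.normSq ((s + 1) ^ (ν - 1)) := Complex.normSq_pos.2 (pow_ne_zero _ hs)
  have hns : Complex.normSq s = t := by
    rw [hs_def, Complex.normSq_mul, Complex.normSq_ofReal, Complex.normSq_I, hω2, mul_one]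
  have h4 : ∑ j : Fin ν, p j * (Complex.normSq (s ^ (j : ℕ) / (s + 1) ^ (ν - 1)) /
      (Nat.factorial (j : ℕ) : ℝ)) = (∑ j : Fin ν, p j * (t ^ (j : ℕ) /
      (Nat.factorial (j : ℕ) : ℝ))) / Complex.normSq ((s + 1) ^ (ν - 1)) := by
    rw [Finset.sum_div]
    refine Finset.sum_congr rfl fun j _ => ?_
    rw [Complex.normSq_div, map_pow, hns]
    ring
  rw [h4] at h3
  by_contra! hneg
  exact absurd h3 (not_le.2 (div_neg_of_neg_of_pos hneg hn))

theorem zfA_mulVec_zero (k : ℕ) (v : Fin (k + 1) → ℝ) : (zfA (k + 1) *ᵥ v) 0 = -v 0 := by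
  simp only [mulVec, dotProduct]
  rw [Finset.sum_eq_single 0]
  · simp [zfA]
  · intro l _ hl
    simp [zfA, hl.symm]
  · simp

theorem zfA_mulVec_succ (k : ℕ) (v : Fin (k + 1) → ℝ) (j : Fin k) :
    (zfA (k + 1) *ᵥ v) j.succ = -v j.succ + v j.castSucc := by
  have hne : j.succ ≠ j.castSucc := by
    intro h
    have := congrArg Fin.val h
    simp at this
  simp only [mulVec, dotProduct]
  rw [Finset.sum_eq_add j.succ j.castSucc hne]
  · simp [zfA, hne]
  · rintro l _ ⟨h1, h2⟩
    have h3 : ¬ ((j : ℕ) = (l : ℕ)) := fun h => h2 (Fin.ext h.symm)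
    simp [zfA, h1.symm, h3]
  · simp
  · simp

/-- The static gain of the filter states: `A_ν⁻¹ B_ν = -(1, …, 1)ᵀ`. -/
theorem zfA_inv_mul_zfB {ν : ℕ} (hν : 1 ≤ ν) (i : Fin ν) : ((zfA ν)⁻¹ * zfB ν) i () = -1 := by
  obtain ⟨k, rfl⟩ : ∃ k, ν = k + 1 := ⟨ν - 1, by omega⟩
  have hdet : (zfA (k + 1)).det = (-1) ^ (k + 1) := by
    rw [det_of_isLowerTriangular]
    · simp [zfA]
    · intro i j hij
      have h1 : (i : ℕ) < (j : ℕ) := by simpa using hij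
      have h2 : i ≠ j := fun h => by simp [h] at h1
      have h3 : ¬ ((i : ℕ) = (j : ℕ) + 1) := by omega
      simp [zfA, h2, h3]
  have hunit : IsUnit (zfA (k + 1)).det := by
    rw [hdet]; exact IsUnit.pow _ (by simp)
  have hB : zfB (k + 1) =
      zfA (k + 1) * (Matrix.of fun _ _ => -1 : Matrix (Fin (k + 1)) Unit ℝ) := by
    ext i u
    change _ = (zfA (k + 1) *ᵥ fun _ => (-1 : ℝ)) i
    refine Fin.cases ?_ (fun j => ?_) i
    · rw [zfA_mulVec_zero]; simp [zfB]
    · rw [zfA_mulVec_succ]; simp [zfB]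
  rw [hB, ← Matrix.mul_assoc, nonsing_inv_mul _ hunit]
  simp

/-- The tail integral `∫_r^∞ e^{-x} x ^ j / j! dx = e^{-r} ∑_{i ≤ j} r ^ i / i!`. -/
def expTail (j : ℕ) (r : ℝ) : ℝ :=
  ∑ i ∈ Finset.range (j + 1), Real.exp (-r) * (r ^ i / (Nat.factorial i : ℝ))

theorem hasDerivAt_expTail (j : ℕ) (r : ℝ) :
    HasDerivAt (expTail j) (-(Real.exp (-r) * (r ^ j / (Nat.factorial j : ℝ)))) r := by
  have he : HasDerivAt (fun r : ℝ => Real.exp (-r)) (-Real.exp (-r)) r := by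
    simpa using (hasDerivAt_neg r).exp
  have hmono : ∀ i : ℕ, HasDerivAt (fun r : ℝ => Real.exp (-r) * (r ^ i / (Nat.factorial i : ℝ)))
      (-Real.exp (-r) * (r ^ i / (Nat.factorial i : ℝ)) +
        Real.exp (-r) * (i * r ^ (i - 1) / (Nat.factorial i : ℝ))) r :=
    fun i => he.mul ((hasDerivAt_pow i r).div_const _)
  induction j with
  | zero =>
    have : expTail 0 = fun r : ℝ => Real.exp (-r) * (r ^ 0 / (Nat.factorial 0 : ℝ)) := by
      ext; simp [expTail]
    rw [this]
    exact (hmono 0).congr_deriv (by simp)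
  | succ j ih =>
    have : expTail (j + 1) = fun r => expTail j r +
        Real.exp (-r) * (r ^ (j + 1) / (Nat.factorial (j + 1) : ℝ)) := by
      ext r
      exact Finset.sum_range_succ _ _
    rw [this]
    refine (ih.add (hmono (j + 1))).congr_deriv ?_
    rw [Nat.factorial_succ]
    have h1 : (Nat.factorial j : ℝ) ≠ 0 := Nat.cast_ne_zero.2 (Nat.factorial_ne_zero _)
    push_cast
    field_simp
    ring

theorem expTail_zero (j : ℕ) : expTail j 0 = 1 := by
  rw [expTail, Finset.sum_range_succ']
  simp

theorem tendsto_expTail (j : ℕ) : Filter.Tendsto (expTail j) Filter.atTop (nhds 0) := by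
  have : (0 : ℝ) = ∑ i ∈ Finset.range (j + 1), 0 := by simp
  rw [this]
  refine tendsto_finsetSum _ fun i _ => ?_
  have := (Real.tendsto_pow_mul_exp_neg_atTop_nhds_zero i).div_const (Nat.factorial i : ℝ)
  rw [zero_div] at this
  refine this.congr fun r => ?_
  ring

/-- The weighted tail `∑ p_j ∫_r^∞ e^{-x} x ^ j / j! dx`. -/
def weightedTail {ν : ℕ} (p : Fin ν → ℝ) (r : ℝ) : ℝ := ∑ j, p j * expTail j r

theorem hasDerivAt_weightedTail {ν : ℕ} (p : Fin ν → ℝ) (r : ℝ) :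
    HasDerivAt (weightedTail p)
      (-(Real.exp (-r) * ∑ j : Fin ν, p j * (r ^ (j : ℕ) / (Nat.factorial (j : ℕ) : ℝ)))) r := by
  have h : HasDerivAt (weightedTail p) (∑ j : Fin ν, p j *
      (-(Real.exp (-r) * (r ^ (j : ℕ) / (Nat.factorial (j : ℕ) : ℝ))))) r := by
    unfold weightedTail
    exact HasDerivAt.fun_sum fun j _ => (hasDerivAt_expTail j r).const_mul (p j)
  refine h.congr_deriv ?_
  rw [Finset.mul_sum, ← Finset.sum_neg_distrib]
  exact Finset.sum_congr rfl fun j _ => by ring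

theorem weightedTail_zero {ν : ℕ} (p : Fin ν → ℝ) : weightedTail p 0 = ∑ j, p j := by
  simp [weightedTail, expTail_zero]

/-- A nonnegative impulse response has nonnegative tail integrals. -/
theorem weightedTail_nonneg {ν : ℕ} {p : Fin ν → ℝ}
    (hp : ∀ t : ℝ, 0 ≤ t → 0 ≤ ∑ j : Fin ν, p j * (t ^ (j : ℕ) / (Nat.factorial (j : ℕ) : ℝ)))
    {r : ℝ} (hr : 0 ≤ r) : 0 ≤ weightedTail p r := by
  have hanti : AntitoneOn (weightedTail p) (Set.Ici 0) := by
    refine antitoneOn_of_deriv_nonpos (convex_Ici 0)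
      (fun s _ => (hasDerivAt_weightedTail p s).continuousAt.continuousWithinAt)
      (fun s _ => (hasDerivAt_weightedTail p s).differentiableAt.differentiableWithinAt)
      fun s hs => ?_
    rw [interior_Ici] at hs
    rw [(hasDerivAt_weightedTail p s).deriv, neg_nonpos]
    exact mul_nonneg (Real.exp_pos _).le (hp s (le_of_lt hs))
  have hlim : Filter.Tendsto (weightedTail p) Filter.atTop (nhds 0) := by
    have : (0 : ℝ) = ∑ j : Fin ν, p j * 0 := by simp
    rw [this]
    exact tendsto_finsetSum _ fun j _ => (tendsto_expTail j).const_mul _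
  refine le_of_tendsto hlim ?_
  filter_upwards [Filter.eventually_ge_atTop r] with s hs
  exact hanti hr (hr.trans hs) hs

/-! ### Iterated integrals and the states of the filter chain -/

/-- The `j`-fold iterated integral of `v` from `0`. -/
def iterInt (v : ℝ → ℝ) : ℕ → ℝ → ℝ
  | 0 => v
  | j + 1 => fun t => ∫ s in (0 : ℝ)..t, iterInt v j s

variable {v w : ℝ → ℝ} {T : ℝ}

theorem iterInt_succ_eq (v : ℝ → ℝ) (j : ℕ) : iterInt v (j + 1) = iterInt (iterInt v 1) j := by
  induction j with
  | zero => rfl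
  | succ j ih =>
    change (fun t => ∫ s in (0 : ℝ)..t, iterInt v (j + 1) s) = _
    rw [ih]
    rfl

theorem iterInt_intervalIntegrable (hv : IntervalIntegrable v volume 0 T) (j : ℕ) :
    IntervalIntegrable (iterInt v j) volume 0 T := by
  induction j with
  | zero => exact hv
  | succ j ih =>
    exact (ih.absolutelyContinuousOnInterval_intervalIntegral
      Set.left_mem_uIcc).continuousOn.intervalIntegrable

theorem iterInt_absolutelyContinuous (hv : IntervalIntegrable v volume 0 T) (j : ℕ) :
    AbsolutelyContinuousOnInterval (iterInt v (j + 1)) 0 T :=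
  (iterInt_intervalIntegrable hv j).absolutelyContinuousOnInterval_intervalIntegral
    Set.left_mem_uIcc

theorem iterInt_ae_hasDerivAt (hv : IntervalIntegrable v volume 0 T) (j : ℕ) :
    ∀ᵐ t, t ∈ Set.uIcc 0 T → HasDerivAt (iterInt v (j + 1)) (iterInt v j t) t := by
  filter_upwards [(iterInt_intervalIntegrable hv j).ae_hasDerivAt_integral] with t ht hmem
  exact ht hmem 0 Set.left_mem_uIcc

/-- Cauchy's formula for repeated integration. -/
theorem iterInt_eq_integral (j : ℕ) {v : ℝ → ℝ} {t : ℝ}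
    (hv : IntervalIntegrable v volume 0 t) :
    iterInt v (j + 1) t = ∫ s in (0 : ℝ)..t, (t - s) ^ j / (Nat.factorial j : ℝ) * v s := by
  induction j generalizing v with
  | zero => simp [iterInt]
  | succ j ih =>
    rw [iterInt_succ_eq, ih (iterInt_intervalIntegrable hv 1)]
    have hder : ∀ s, HasDerivAt (fun s : ℝ => (t - s) ^ (j + 1) / (Nat.factorial (j + 1) : ℝ))
        (-((t - s) ^ j / (Nat.factorial j : ℝ))) s := by
      intro s
      refine ((((hasDerivAt_id s).const_sub t).pow (j + 1)).div_const _).congr_deriv ?_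
      have h1 : (Nat.factorial j : ℝ) ≠ 0 := Nat.cast_ne_zero.2 (Nat.factorial_ne_zero _)
      rw [Nat.factorial_succ]
      push_cast
      simp only [id]
      field_simp
    have hf : AbsolutelyContinuousOnInterval
        (fun s : ℝ => (t - s) ^ (j + 1) / (Nat.factorial (j + 1) : ℝ)) 0 t := by
      refine ContDiffOn.absolutelyContinuousOnInterval ?_
      fun_prop
    have hparts := hf.integral_mul_deriv_eq_deriv_mul (iterInt_absolutelyContinuous hv 0)
    have e1 : ∫ s in (0 : ℝ)..t, (t - s) ^ (j + 1) / (Nat.factorial (j + 1) : ℝ) *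
        deriv (iterInt v (0 + 1)) s =
        ∫ s in (0 : ℝ)..t, (t - s) ^ (j + 1) / (Nat.factorial (j + 1) : ℝ) * v s := by
      refine intervalIntegral.integral_congr_ae ?_
      filter_upwards [iterInt_ae_hasDerivAt hv 0] with s hs hmem
      rw [(hs (Set.uIoc_subset_uIcc hmem)).deriv, iterInt]
    rw [e1] at hparts
    rw [hparts]
    have e0 : iterInt v (0 + 1) 0 = 0 := intervalIntegral.integral_same
    simp only [e0, sub_self, mul_zero, zero_add]
    rw [zero_pow (Nat.succ_ne_zero j), zero_div, zero_mul, sub_zero, zero_sub,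
      ← intervalIntegral.integral_neg]
    refine intervalIntegral.integral_congr fun s _ => ?_
    simp only [(hder s).deriv]
    ring

/-- The `j`-th state of the chain `x_0' = -β x_0 + v`, `x_{j+1}' = -β x_{j+1} + x_j` started at
`0`. -/
def filt (β : ℝ) (v : ℝ → ℝ) (j : ℕ) (t : ℝ) : ℝ :=
  Real.exp (-(β * t)) * iterInt (fun s => Real.exp (β * s) * v s) (j + 1) t

/-- The input of the `j`-th state of the filter chain. -/
def filtIn (β : ℝ) (v : ℝ → ℝ) : ℕ → ℝ → ℝ
  | 0 => v
  | j + 1 => filt β v j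

theorem exp_mul_intervalIntegrable (β : ℝ) (hv : IntervalIntegrable v volume 0 T) :
    IntervalIntegrable (fun s => Real.exp (β * s) * v s) volume 0 T :=
  hv.continuousOn_mul (by fun_prop)

theorem hasDerivAt_exp_neg_mul (β t : ℝ) :
    HasDerivAt (fun t : ℝ => Real.exp (-(β * t))) (-β * Real.exp (-(β * t))) t := by
  have := ((hasDerivAt_id t).const_mul β).neg.exp
  refine this.congr_deriv ?_
  simp; ring

theorem filt_zero (β : ℝ) (v : ℝ → ℝ) (j : ℕ) : filt β v j 0 = 0 := by
  simp [filt, iterInt]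

theorem filt_absolutelyContinuous (β : ℝ) (hv : IntervalIntegrable v volume 0 T) (j : ℕ) :
    AbsolutelyContinuousOnInterval (filt β v j) 0 T := by
  have h1 : AbsolutelyContinuousOnInterval (fun t : ℝ => Real.exp (-(β * t))) 0 T :=
    ContDiffOn.absolutelyContinuousOnInterval (by fun_prop)
  exact h1.fun_mul (iterInt_absolutelyContinuous (exp_mul_intervalIntegrable β hv) j)

theorem filt_ae_hasDerivAt (β : ℝ) (hv : IntervalIntegrable v volume 0 T) (j : ℕ) :
    ∀ᵐ t, t ∈ Set.uIcc 0 T →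
      HasDerivAt (filt β v j) (-β * filt β v j t + filtIn β v j t) t := by
  filter_upwards [iterInt_ae_hasDerivAt (exp_mul_intervalIntegrable β hv) j] with t ht hmem
  refine ((hasDerivAt_exp_neg_mul β t).mul (ht hmem)).congr_deriv ?_
  have : Real.exp (-(β * t)) * iterInt (fun s => Real.exp (β * s) * v s) j t = filtIn β v j t := by
    cases j with
    | zero => rw [iterInt, ← mul_assoc, ← Real.exp_add]; simp [filtIn]
    | succ j => rfl
  rw [this, filt]
  ring

/-- The filter states as convolutions with `e^{-β r} r ^ j / j!`. -/
theorem filt_eq_integral (β : ℝ) {t : ℝ} (hv : IntervalIntegrable v volume 0 t) (j : ℕ) :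
    filt β v j t = ∫ s in (0 : ℝ)..t,
      Real.exp (-(β * (t - s))) * ((t - s) ^ j / (Nat.factorial j : ℝ)) * v s := by
  rw [filt, iterInt_eq_integral j (exp_mul_intervalIntegrable β hv),
    ← intervalIntegral.integral_const_mul]
  refine intervalIntegral.integral_congr fun s _ => ?_
  have : Real.exp (-(β * (t - s))) = Real.exp (-(β * t)) * Real.exp (β * s) := by
    rw [← Real.exp_add]; ring_nf
  simp only [this]
  ring

/-- Exponential weighting shifts the pole of the filter chain. -/
theorem filt_exp_weight (β γ : ℝ) (v : ℝ → ℝ) (j : ℕ) (t : ℝ) :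
    filt (β - γ) (fun s => Real.exp (γ * s) * v s) j t = Real.exp (γ * t) * filt β v j t := by
  have : (fun s => Real.exp ((β - γ) * s) * (Real.exp (γ * s) * v s)) =
      fun s => Real.exp (β * s) * v s := by
    ext s
    rw [← mul_assoc, ← Real.exp_add]
    ring_nf
  rw [filt, filt, this, ← mul_assoc, ← Real.exp_add]
  ring_nf

theorem kernel_intervalIntegrable (β : ℝ) {t : ℝ} (hv : IntervalIntegrable v volume 0 t) (j : ℕ) :
    IntervalIntegrable (fun s =>
      Real.exp (-(β * (t - s))) * ((t - s) ^ j / (Nat.factorial j : ℝ)) * v s) volume 0 t :=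
  hv.continuousOn_mul (by fun_prop)

/-- The filter states are linear in the input. -/
theorem filt_sum_sub {ι : Type} [Fintype ι] (β : ℝ) {t : ℝ} {p : ι → ℝ → ℝ} (r : ι → ℝ)
    (hp : ∀ a, IntervalIntegrable (p a) volume 0 t) (hw : IntervalIntegrable w volume 0 t)
    (j : ℕ) :
    filt β (fun s => ∑ a, r a * p a s - w s) j t =
      ∑ a, r a * filt β (p a) j t - filt β w j t := by
  have hsum : IntervalIntegrable (fun s => ∑ a, r a * p a s) volume 0 t := by
    have := IntervalIntegrable.sum Finset.univ (f := fun a s => r a * p a s)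
      fun a _ => (hp a).const_mul (r a)
    simpa only [Finset.sum_fn] using this
  rw [filt_eq_integral β (hsum.sub hw), filt_eq_integral β hw]
  simp only [filt_eq_integral β (hp _), ← intervalIntegral.integral_const_mul]
  rw [← intervalIntegral.integral_finsetSum fun a _ =>
      (kernel_intervalIntegrable β (hp a) j).const_mul (r a),
    ← intervalIntegral.integral_sub _ (kernel_intervalIntegrable β hw j)]
  · refine intervalIntegral.integral_congr fun s _ => ?_
    simp only [mul_sub, Finset.mul_sum]
    congr 1
    exact Finset.sum_congr rfl fun a _ => by ring
  · have := IntervalIntegrable.sum Finset.univ (f := fun a s => r a *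
      (Real.exp (-(β * (t - s))) * ((t - s) ^ j / (Nat.factorial j : ℝ)) * p a s))
      fun a _ => (kernel_intervalIntegrable β (hp a) j).const_mul (r a)
    simpa only [Finset.sum_fn] using this

/-! ### Zames-Falb inequalities for the filter states and their storage function -/

section ZamesFalb

variable {ν : ℕ} {p : Fin ν → ℝ} {β t T : ℝ} {v : ℝ → ℝ}

theorem sum_filt_eq_integral (p : Fin ν → ℝ) (β : ℝ) (hv : IntervalIntegrable v volume 0 t) :
    ∑ j, p j * filt β v j t = ∫ s in (0 : ℝ)..t, Real.exp (-(β * (t - s))) *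
      (∑ j : Fin ν, p j * ((t - s) ^ (j : ℕ) / (Nat.factorial (j : ℕ) : ℝ))) * v s := by
  simp only [filt_eq_integral β hv, ← intervalIntegral.integral_const_mul]
  rw [← intervalIntegral.integral_finsetSum fun (j : Fin ν) _ =>
      (kernel_intervalIntegrable β hv (j : ℕ)).const_mul (p j)]
  refine intervalIntegral.integral_congr fun s _ => ?_
  simp only [Finset.mul_sum, Finset.sum_mul]
  exact Finset.sum_congr rfl fun j _ => by ring

/-- The combination of filter states with nonnegative impulse response has gain at most `∑ p_j`. -/
theorem sum_filt_le
    (hp : ∀ t : ℝ, 0 ≤ t → 0 ≤ ∑ j : Fin ν, p j * (t ^ (j : ℕ) / (Nat.factorial (j : ℕ) : ℝ)))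
    (hβ : 1 ≤ β) (ht : 0 ≤ t) (hv : IntervalIntegrable v volume 0 t) {E : ℝ} (hE : 0 ≤ E)
    (hvE : ∀ s ∈ Set.Icc 0 t, v s ≤ E) : ∑ j, p j * filt β v j t ≤ (∑ j, p j) * E := by
  set K : ℝ → ℝ := fun r => ∑ j : Fin ν, p j * (r ^ (j : ℕ) / (Nat.factorial (j : ℕ) : ℝ)) with hK
  have hKc : Continuous K := by simp only [hK]; fun_prop
  have hint : ∫ s in (0 : ℝ)..t, Real.exp (-(t - s)) * K (t - s) * E =
      (weightedTail p 0 - weightedTail p t) * E := by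
    rw [intervalIntegral.integral_mul_const]
    congr 1
    have hd : ∀ s ∈ Set.uIcc 0 t, HasDerivAt (fun s => weightedTail p (t - s))
        (Real.exp (-(t - s)) * K (t - s)) s := by
      intro s _
      have := (hasDerivAt_weightedTail p (t - s)).comp s ((hasDerivAt_id s).const_sub t)
      refine this.congr_deriv ?_
      simp [hK]
    rw [intervalIntegral.integral_eq_sub_of_hasDerivAt hd]
    · simp
    · exact Continuous.intervalIntegrable (by fun_prop) _ _
  calc ∑ j, p j * filt β v j t
      = ∫ s in (0 : ℝ)..t, Real.exp (-(β * (t - s))) * K (t - s) * v s :=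
        sum_filt_eq_integral p β hv
    _ ≤ ∫ s in (0 : ℝ)..t, Real.exp (-(t - s)) * K (t - s) * E := by
        refine intervalIntegral.integral_mono_on ht (hv.continuousOn_mul (by fun_prop))
          (Continuous.intervalIntegrable (by fun_prop) _ _) fun s hs => ?_
        have hts : 0 ≤ t - s := by linarith [hs.2]
        have hKs : 0 ≤ K (t - s) := hp _ hts
        have h1 : Real.exp (-(β * (t - s))) ≤ Real.exp (-(t - s)) := by
          apply Real.exp_le_exp.2
          nlinarith
        calc Real.exp (-(β * (t - s))) * K (t - s) * v s
            ≤ Real.exp (-(β * (t - s))) * K (t - s) * E :=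
              mul_le_mul_of_nonneg_left (hvE s hs) (mul_nonneg (Real.exp_pos _).le hKs)
          _ ≤ Real.exp (-(t - s)) * K (t - s) * E := by gcongr
    _ = (weightedTail p 0 - weightedTail p t) * E := hint
    _ ≤ (∑ j, p j) * E := by
        rw [weightedTail_zero]
        have := weightedTail_nonneg hp ht
        gcongr
        linarith

/-- If the correlation of `r` with the increments `q(t) - q(s)` dominates the increments of `ψ`,
then this persists for differences with causal averages over the past. -/
theorem zamesFalb_pointwise {ι : Type} [Fintype ι]
    (hp : ∀ t : ℝ, 0 ≤ t → 0 ≤ ∑ j : Fin ν, p j * (t ^ (j : ℕ) / (Nat.factorial (j : ℕ) : ℝ)))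
    (hβ : 1 ≤ β) (ht : 0 ≤ t) {q : ι → ℝ → ℝ} {ψ : ℝ → ℝ} {r : ι → ℝ}
    (hq : ∀ a, IntervalIntegrable (q a) volume 0 t) (hψ : IntervalIntegrable ψ volume 0 t)
    (hinc : ∀ s ∈ Set.Icc 0 t, ψ t - ψ s ≤ ∑ a, r a * (q a t - q a s))
    (hfull : ψ t ≤ ∑ a, r a * q a t) :
    (∑ j, p j) * ψ t - ∑ j, p j * filt β ψ j t ≤
      ∑ a, r a * ((∑ j, p j) * q a t - ∑ j, p j * filt β (q a) j t) := by
  have hsum : IntervalIntegrable (fun s => ∑ a, r a * q a s) volume 0 t := by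
    have := IntervalIntegrable.sum Finset.univ (f := fun a s => r a * q a s)
      fun a _ => (hq a).const_mul (r a)
    simpa only [Finset.sum_fn] using this
  have key := sum_filt_le (v := fun s => ∑ a, r a * q a s - ψ s) hp hβ ht (hsum.sub hψ)
    (E := ∑ a, r a * q a t - ψ t) (by linarith) fun s hs => by
      have := hinc s hs
      simp only [mul_sub, Finset.sum_sub_distrib] at this
      linarith
  simp only [filt_sum_sub β r hq hψ] at key
  have e1 : ∑ a, r a * ((∑ j, p j) * q a t - ∑ j, p j * filt β (q a) j t) =
      (∑ j, p j) * ∑ a, r a * q a t - ∑ j : Fin ν, p j * ∑ a, r a * filt β (q a) j t := by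
    simp only [mul_sub, Finset.sum_sub_distrib]
    congr 1
    · rw [Finset.mul_sum]
      exact Finset.sum_congr rfl fun a _ => by ring
    · simp only [Finset.mul_sum]
      rw [Finset.sum_comm]
      exact Finset.sum_congr rfl fun j _ => Finset.sum_congr rfl fun a _ => by ring
  simp only [mul_sub, Finset.sum_sub_distrib] at key
  rw [e1]
  linarith

/-- Storage function certifying that `e^{2 α t} ∑ p_j (ψ - x_j)` has nonnegative integrals, where
`x_j` are the filter states driven by `ψ`: its derivative is that signal, and it is a convolution of
`e^{2 α t} ψ` with tail integrals of the impulse response. -/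
def zfStorage (α : ℝ) (p : Fin ν → ℝ) (ψ : ℝ → ℝ) (t : ℝ) : ℝ :=
  ∑ j : Fin ν, p j * ∑ i ∈ Finset.range ((j : ℕ) + 1),
    filt 1 (fun s => Real.exp (2 * α * s) * ψ s) i t

theorem zfStorage_zero (α : ℝ) (p : Fin ν → ℝ) (ψ : ℝ → ℝ) : zfStorage α p ψ 0 = 0 := by
  simp [zfStorage, filt_zero]

theorem absolutelyContinuous_const (c a b : ℝ) :
    AbsolutelyContinuousOnInterval (fun _ : ℝ => c) a b :=
  ContDiffOn.absolutelyContinuousOnInterval contDiffOn_const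

theorem absolutelyContinuous_sum {κ : Type} (s : Finset κ) {F : κ → ℝ → ℝ} {a b : ℝ}
    (h : ∀ k ∈ s, AbsolutelyContinuousOnInterval (F k) a b) :
    AbsolutelyContinuousOnInterval (fun t => ∑ k ∈ s, F k t) a b := by
  classical
  induction s using Finset.induction_on with
  | empty => simpa using absolutelyContinuous_const 0 a b
  | insert k s hk ih =>
    simp only [Finset.sum_insert hk]
    exact (h k (Finset.mem_insert_self k s)).fun_add
      (ih fun l hl => h l (Finset.mem_insert_of_mem hl))

theorem zfStorage_absolutelyContinuous (α : ℝ) (p : Fin ν → ℝ) {ψ : ℝ → ℝ}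
    (hψ : IntervalIntegrable ψ volume 0 T) :
    AbsolutelyContinuousOnInterval (zfStorage α p ψ) 0 T :=
  absolutelyContinuous_sum _ fun _ _ => (absolutelyContinuous_sum _ fun i _ =>
    filt_absolutelyContinuous 1 (exp_mul_intervalIntegrable (2 * α) hψ) i).const_mul _

theorem zfStorage_ae_hasDerivAt (α : ℝ) (p : Fin ν → ℝ) {ψ : ℝ → ℝ}
    (hψ : IntervalIntegrable ψ volume 0 T) :
    ∀ᵐ t, t ∈ Set.uIcc 0 T → HasDerivAt (zfStorage α p ψ) (Real.exp (2 * α * t) *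
      ((∑ j, p j) * ψ t - ∑ j, p j * filt (1 + 2 * α) ψ j t)) t := by
  set w : ℝ → ℝ := fun s => Real.exp (2 * α * s) * ψ s with hw
  have hwi : IntervalIntegrable w volume 0 T := exp_mul_intervalIntegrable (2 * α) hψ
  filter_upwards [ae_all_iff.2 fun i : ℕ => filt_ae_hasDerivAt 1 hwi i] with t ht hmem
  have h1 : HasDerivAt (zfStorage α p ψ) (∑ j : Fin ν, p j * ∑ i ∈ Finset.range ((j : ℕ) + 1),
      (-1 * filt 1 w i t + filtIn 1 w i t)) t := by
    unfold zfStorage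
    exact HasDerivAt.fun_sum fun j _ =>
      (HasDerivAt.fun_sum fun i _ => ht i hmem).const_mul (p j)
  refine h1.congr_deriv ?_
  -- the inner sum telescopes
  have htel : ∀ j : ℕ, ∑ i ∈ Finset.range (j + 1), (-1 * filt 1 w i t + filtIn 1 w i t) =
      w t - filt 1 w j t := by
    intro j
    induction j with
    | zero => simp [filtIn]; ring
    | succ j ih => rw [Finset.sum_range_succ, ih]; simp [filtIn]; ring
  have hshift : ∀ j : ℕ, filt 1 w j t = Real.exp (2 * α * t) * filt (1 + 2 * α) ψ j t := by
    intro j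
    rw [← filt_exp_weight, add_sub_cancel_right]
  simp only [htel]
  simp only [hshift]
  rw [show w t = Real.exp (2 * α * t) * ψ t from rfl]
  rw [mul_sub, Finset.sum_mul, Finset.mul_sum, Finset.mul_sum, ← Finset.sum_sub_distrib]
  exact Finset.sum_congr rfl fun j _ => by ring

theorem zfStorage_nonneg (α : ℝ)
    (hp : ∀ t : ℝ, 0 ≤ t → 0 ≤ ∑ j : Fin ν, p j * (t ^ (j : ℕ) / (Nat.factorial (j : ℕ) : ℝ)))
    (ht : 0 ≤ t) {ψ : ℝ → ℝ} (hψ : IntervalIntegrable ψ volume 0 t)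
    (hpos : ∀ s ∈ Set.Icc 0 t, 0 ≤ ψ s) : 0 ≤ zfStorage α p ψ t := by
  set w : ℝ → ℝ := fun s => Real.exp (2 * α * s) * ψ s with hw
  have hwi : IntervalIntegrable w volume 0 t := exp_mul_intervalIntegrable (2 * α) hψ
  have h1 : zfStorage α p ψ t = ∫ s in (0 : ℝ)..t, weightedTail p (t - s) * w s := by
    change ∑ j : Fin ν, p j * ∑ i ∈ Finset.range ((j : ℕ) + 1), filt 1 w i t = _
    have hi : ∀ i : ℕ, IntervalIntegrable (fun s => Real.exp (-(t - s)) *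
        ((t - s) ^ i / (Nat.factorial i : ℝ)) * w s) volume 0 t := fun i =>
      hwi.continuousOn_mul (by fun_prop)
    have hinner : ∀ j : ℕ, ∑ i ∈ Finset.range (j + 1), filt 1 w i t =
        ∫ s in (0 : ℝ)..t, expTail j (t - s) * w s := by
      intro j
      simp only [filt_eq_integral 1 hwi, one_mul]
      rw [← intervalIntegral.integral_finsetSum fun i _ => hi i]
      refine intervalIntegral.integral_congr fun s _ => ?_
      simp only [expTail, Finset.sum_mul]
    have htc : ∀ j : ℕ, Continuous (expTail j) := fun j =>
      continuous_iff_continuousAt.2 fun r => (hasDerivAt_expTail j r).continuousAt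
    have hj : ∀ j : Fin ν, IntervalIntegrable
        (fun s => p j * (expTail j (t - s) * w s)) volume 0 t := fun j =>
      (hwi.continuousOn_mul ((htc j).comp
        (continuous_const.sub continuous_id)).continuousOn).const_mul (p j)
    simp only [hinner, ← intervalIntegral.integral_const_mul]
    rw [← intervalIntegral.integral_finsetSum fun j _ => hj j]
    refine intervalIntegral.integral_congr fun s _ => ?_
    simp only [weightedTail, Finset.sum_mul]
    exact Finset.sum_congr rfl fun j _ => by rw [mul_assoc]
  rw [h1]
  refine intervalIntegral.integral_nonneg ht fun s hs => ?_
  exact mul_nonneg (weightedTail_nonneg hp (by linarith [hs.2]))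
    (mul_nonneg (Real.exp_pos _).le (hpos s hs))

/-- An absolutely continuous function with almost everywhere nonpositive derivative does not
increase. -/
theorem le_of_ae_hasDerivAt_nonpos {F : ℝ → ℝ} {T : ℝ} (hT : 0 ≤ T)
    (hF : AbsolutelyContinuousOnInterval F 0 T)
    (h : ∀ᵐ t, t ∈ Set.Ioo 0 T → ∃ d ≤ 0, HasDerivAt F d t) : F T ≤ F 0 := by
  have h1 := hF.integral_deriv_eq_sub
  have h2 : ∫ t in (0 : ℝ)..T, deriv F t ≤ 0 := by
    rw [intervalIntegral.integral_of_le hT, integral_Ioc_eq_integral_Ioo]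
    refine integral_nonpos_of_ae ?_
    rw [Filter.EventuallyLE, ae_restrict_iff' measurableSet_Ioo]
    filter_upwards [h] with t ht hmem
    obtain ⟨d, hd, hder⟩ := ht hmem
    rw [hder.deriv]
    exact hd
  linarith

end ZamesFalb

/-! ### The dissipation inequality of one agent -/

section Dissipation

variable {nx d nρ ν : ℕ}

theorem kron_one_mulVec {r s : Type} [Fintype s] (A : Matrix r s ℝ) (v : s × Fin d → ℝ)
    (i : r) (a : Fin d) :
    ((A ⊗ₖ (1 : Matrix (Fin d) (Fin d) ℝ)) *ᵥ v) (i, a) = (A *ᵥ fun j => v (j, a)) i := by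
  simp only [mulVec, dotProduct, kronecker_apply, Fintype.sum_prod_type]
  refine Finset.sum_congr rfl fun j _ => ?_
  rw [Finset.sum_eq_single a]
  · simp
  · intro b _ hb
    simp [one_apply_ne hb.symm]
  · simp

/-- The state of one agent and of its two filter banks, which hold one chain per output
coordinate. -/
def agentVec (ζ : AgentState nx d → ℝ) (x₁ x₂ : Fin d → Fin ν → ℝ) :
    AgentState nx d ⊕ (Fin ν ⊕ Fin ν) × Fin d → ℝ :=
  Sum.elim ζ fun k => Sum.elim (x₁ k.2) (x₂ k.2) k.1

theorem extended_output (G : Vehicle nx d nρ) (ρ : EuclideanSpace ℝ (Fin nρ))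
    (ζ : AgentState nx d → ℝ) (u e : Fin d → ℝ) (k : Fin 2) (a : Fin d) :
    ((G.extended ρ).C *ᵥ ζ + (G.extended ρ).D *ᵥ Sum.elim u e) (k, a) =
      ![(G.CG ρ *ᵥ ζ) a, u a] k := by
  fin_cases k
  · simp [Vehicle.extended, mulVec, dotProduct]
  · simp only [Vehicle.extended, Pi.add_apply, mulVec, dotProduct, Fintype.sum_sum_type]
    simp [one_apply]

theorem filterRow_mulVec (c₀ c₁ b₀ b₁ : ℝ) :
    (Matrix.of fun _ j => ![c₀, c₁] j : Matrix Unit (Fin 2) ℝ) *ᵥ ![b₀, b₁] =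
      fun _ => c₀ * b₀ + c₁ * b₁ := by
  ext
  simp [mulVec, dotProduct, Fin.sum_univ_two]

theorem series_dynamics {n₁ n₂ p r q : Type} [Fintype n₁] [Fintype n₂] [Fintype p] [Fintype r]
    (S₂ : StateSpace n₂ r q) (S₁ : StateSpace n₁ p r) (x₁ : n₁ → ℝ) (x₂ : n₂ → ℝ) (w : p → ℝ) :
    (S₂.series S₁).A *ᵥ Sum.elim x₁ x₂ + (S₂.series S₁).B *ᵥ w =
      Sum.elim (S₁.A *ᵥ x₁ + S₁.B *ᵥ w) (S₂.A *ᵥ x₂ + S₂.B *ᵥ (S₁.C *ᵥ x₁ + S₁.D *ᵥ w)) := by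
  rw [StateSpace.series, fromBlocks_mulVec, fromRows_mulVec, mulVec_add, mulVec_mulVec,
    mulVec_mulVec]
  ext (i | i)
  · simp
  · simp only [Sum.elim_comp_inl, Sum.elim_comp_inr, Pi.add_apply, Sum.elim_inr]
    ring

theorem series_output {n₁ n₂ p r q : Type} [Fintype n₁] [Fintype n₂] [Fintype p] [Fintype r]
    (S₂ : StateSpace n₂ r q) (S₁ : StateSpace n₁ p r) (x₁ : n₁ → ℝ) (x₂ : n₂ → ℝ) (w : p → ℝ) :
    (S₂.series S₁).C *ᵥ Sum.elim x₁ x₂ + (S₂.series S₁).D *ᵥ w =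
      S₂.C *ᵥ x₂ + S₂.D *ᵥ (S₁.C *ᵥ x₁ + S₁.D *ᵥ w) := by
  simp only [StateSpace.series]
  rw [fromCols_mulVec_sumElim, mulVec_add, mulVec_mulVec, mulVec_mulVec]
  abel

/-- The dynamics of the filters, one output coordinate at a time. -/
theorem filtered_dynamics (G : Vehicle nx d nρ) (α m L : ℝ) (ρ : EuclideanSpace ℝ (Fin nρ))
    (ζ : AgentState nx d → ℝ) (x₁ x₂ : Fin d → Fin ν → ℝ) (u e : Fin d → ℝ) :
    (G.filtered ν α m L ρ).A *ᵥ agentVec ζ x₁ x₂ +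
        (G.filtered ν α m L ρ).B *ᵥ Sum.elim u e =
      agentVec (G.AG ρ *ᵥ ζ + G.BG ρ *ᵥ u + G.BG ρ *ᵥ e)
        (fun a => zfAα ν α *ᵥ x₁ a + zfB ν *ᵥ fun _ => u a - m * (G.CG ρ *ᵥ ζ) a)
        (fun a => zfAα ν α *ᵥ x₂ a + zfB ν *ᵥ fun _ => L * (G.CG ρ *ᵥ ζ) a - u a) := by
  rw [Vehicle.filtered, agentVec, series_dynamics]
  set y := G.CG ρ *ᵥ ζ with hy
  unfold agentVec
  congr 1
  · simp only [Vehicle.extended]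
    rw [fromCols_mulVec_sumElim, add_assoc]
  · ext ⟨k, a⟩
    simp only [StateSpace.kronId, Pi.add_apply]
    rw [kron_one_mulVec, kron_one_mulVec]
    have hout : (fun j => ((G.extended ρ).C *ᵥ ζ + (G.extended ρ).D *ᵥ Sum.elim u e) (j, a)) =
        ![y a, u a] := by
      ext j
      rw [extended_output]
    rw [hout]
    have hvec : (fun j => Sum.elim (x₁ a) (x₂ a) j) = Sum.elim (x₁ a) (x₂ a) := rfl
    simp only [piML]
    rw [fromBlocks_mulVec, fromRows_mulVec, ← mulVec_mulVec, ← mulVec_mulVec, filterRow_mulVec,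
      filterRow_mulVec]
    rcases k with j | j
    · simp only [hvec, Sum.elim_comp_inl, Sum.elim_comp_inr, Sum.elim_inl, Pi.add_apply,
        zero_mulVec, add_zero]
      congr 3
      ext
      ring
    · simp only [hvec, Sum.elim_comp_inl, Sum.elim_comp_inr, Sum.elim_inr, Pi.add_apply,
        zero_mulVec, zero_add]
      congr 3
      ext
      ring

theorem filtered_output (G : Vehicle nx d nρ) (α m L : ℝ) (ρ : EuclideanSpace ℝ (Fin nρ))
    (ζ : AgentState nx d → ℝ) (x₁ x₂ : Fin d → Fin ν → ℝ) (u e : Fin d → ℝ) (a : Fin d) :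
    (fun k => ((G.filtered ν α m L ρ).C *ᵥ agentVec ζ x₁ x₂ +
        (G.filtered ν α m L ρ).D *ᵥ Sum.elim u e) (k, a)) =
      Sum.elim (Sum.elim (fun _ => u a - m * (G.CG ρ *ᵥ ζ) a) (x₁ a))
        (Sum.elim (fun _ => L * (G.CG ρ *ᵥ ζ) a - u a) (x₂ a)) := by
  rw [Vehicle.filtered, agentVec, series_output]
  set y := G.CG ρ *ᵥ ζ with hy
  ext k
  simp only [StateSpace.kronId, Pi.add_apply]
  rw [kron_one_mulVec, kron_one_mulVec]
  have hout : (fun j => ((G.extended ρ).C *ᵥ ζ + (G.extended ρ).D *ᵥ Sum.elim u e) (j, a)) =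
      ![y a, u a] := by
    ext j
    rw [extended_output]
  rw [hout]
  have hvec : (fun j => Sum.elim (x₁ a) (x₂ a) j) = Sum.elim (x₁ a) (x₂ a) := rfl
  simp only [piML]
  rw [fromBlocks_mulVec, fromRows_mulVec, fromRows_mulVec, fromRows_mulVec, fromRows_mulVec,
    fromRows_mulVec, filterRow_mulVec, filterRow_mulVec]
  simp only [hvec, Sum.elim_comp_inl, Sum.elim_comp_inr, zero_mulVec, one_mulVec]
  rcases k with (j | j) | (j | j)
  · simp; ring
  · simp
  · simp; ring
  · simp

/-- The quadratic form of a block-coordinatewise matrix is the sum over the coordinates. -/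
theorem kron_one_quadForm {r : Type} [Fintype r] (A : Matrix r r ℝ) (v : r × Fin d → ℝ) :
    v ⬝ᵥ (A ⊗ₖ (1 : Matrix (Fin d) (Fin d) ℝ)) *ᵥ v =
      ∑ a, (fun j => v (j, a)) ⬝ᵥ A *ᵥ fun j => v (j, a) := by
  simp only [dotProduct, Fintype.sum_prod_type]
  rw [Finset.sum_comm]
  refine Finset.sum_congr rfl fun a _ => Finset.sum_congr rfl fun i _ => ?_
  rw [kron_one_mulVec, mulVec, dotProduct]

theorem zfMatrix_quadForm (H : ℝ) (P₁ P₃ : Fin ν → ℝ) (q r : ℝ) (x₁ x₂ : Fin ν → ℝ) :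
    Sum.elim (Sum.elim (fun _ : Unit => q) x₁) (Sum.elim (fun _ : Unit => r) x₂) ⬝ᵥ
      zfMatrix ν H P₁ P₃ *ᵥ
        Sum.elim (Sum.elim (fun _ : Unit => q) x₁) (Sum.elim (fun _ : Unit => r) x₂) =
      2 * (H * (q * r) - q * ∑ j, P₃ j * x₂ j - r * ∑ j, P₁ j * x₁ j) := by
  simp only [zfMatrix, fromBlocks_transpose]
  rw [fromBlocks_mulVec, fromBlocks_mulVec, fromBlocks_mulVec]
  simp only [Sum.elim_comp_inl, Sum.elim_comp_inr, zero_mulVec, add_zero, zero_add,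
    sumElim_dotProduct_sumElim, transpose_zero]
  simp only [dotProduct, mulVec, of_apply, transpose_apply, Pi.add_apply, Finset.univ_unique,
    Finset.sum_singleton, neg_mul, Finset.sum_neg_distrib]
  have e1 : ∑ i, x₁ i * -(P₁ i * r) = -(r * ∑ j, P₁ j * x₁ j) := by
    rw [Finset.mul_sum, ← Finset.sum_neg_distrib]
    exact Finset.sum_congr rfl fun j _ => by ring
  have e2 : ∑ i, x₂ i * -(P₃ i * q) = -(q * ∑ j, P₃ j * x₂ j) := by
    rw [Finset.mul_sum, ← Finset.sum_neg_distrib]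
    exact Finset.sum_congr rfl fun j _ => by ring
  rw [e1, e2]
  ring

theorem noise_quadForm (δ : ℝ) (u e : Fin d → ℝ) :
    (noiseD d *ᵥ Sum.elim u e) ⬝ᵥ (noiseM δ ⊗ₖ (1 : Matrix (Fin d) (Fin d) ℝ)) *ᵥ
      (noiseD d *ᵥ Sum.elim u e) = δ ^ 2 * ∑ a, u a ^ 2 - ∑ a, e a ^ 2 := by
  have h : ∀ a, (fun j => (noiseD d *ᵥ Sum.elim u e) (j, a)) = ![e a, u a] := by
    intro a
    ext k
    fin_cases k
    · simp [noiseD, mulVec, dotProduct, one_apply]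
    · simp [noiseD, mulVec, dotProduct, one_apply]
  rw [kron_one_quadForm]
  simp only [h]
  rw [Finset.mul_sum, ← Finset.sum_sub_distrib]
  refine Finset.sum_congr rfl fun a _ => ?_
  simp [noiseM, mulVec, dotProduct, Fin.sum_univ_two]
  ring

/-- The quadratic form of the LMI is the derivative of the energy along the dynamics, plus `2 α`
times the energy, plus the multiplier terms in the filter output `z` and in the noise. -/
theorem lmi_quadForm (G : Vehicle nx d nρ) (α m L δ lam : ℝ)
    (X₀ : Matrix (AgentState nx d ⊕ (Fin ν ⊕ Fin ν) × Fin d)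
      (AgentState nx d ⊕ (Fin ν ⊕ Fin ν) × Fin d) ℝ)
    (P : Matrix (PiOut ν ⊕ PiOut ν) (PiOut ν ⊕ PiOut ν) ℝ) (ρ : EuclideanSpace ℝ (Fin nρ))
    (ξ : AgentState nx d ⊕ (Fin ν ⊕ Fin ν) × Fin d → ℝ) (w : Fin d ⊕ Fin d → ℝ) :
    let S := G.filtered ν α m L ρ
    let z := S.C *ᵥ ξ + S.D *ᵥ w
    Sum.elim ξ w ⬝ᵥ G.lmi ν α m L δ lam X₀ P ρ *ᵥ Sum.elim ξ w =
      (S.A *ᵥ ξ + S.B *ᵥ w) ⬝ᵥ X₀ *ᵥ ξ + ξ ⬝ᵥ X₀ *ᵥ (S.A *ᵥ ξ + S.B *ᵥ w) +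
        2 * α * (ξ ⬝ᵥ X₀ *ᵥ ξ) + z ⬝ᵥ (P ⊗ₖ (1 : Matrix (Fin d) (Fin d) ℝ)) *ᵥ z +
        lam * ((noiseD d *ᵥ w) ⬝ᵥ (noiseM δ ⊗ₖ (1 : Matrix (Fin d) (Fin d) ℝ)) *ᵥ
          (noiseD d *ᵥ w)) := by
  intro S z
  have hW : fromBlocks S.C S.D 0 (noiseD d) *ᵥ Sum.elim ξ w = Sum.elim z (noiseD d *ᵥ w) := by
    rw [fromBlocks_mulVec]
    simp [z]
  have hlmi : G.lmi ν α m L δ lam X₀ P ρ =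
      fromBlocks (S.Aᵀ * X₀ + X₀ * S.A + (2 * α) • X₀) (X₀ * S.B) (S.Bᵀ * X₀) 0 +
      (fromBlocks S.C S.D 0 (noiseD d))ᵀ *
        fromBlocks (P ⊗ₖ (1 : Matrix (Fin d) (Fin d) ℝ)) 0 0
          (lam • (noiseM δ ⊗ₖ (1 : Matrix (Fin d) (Fin d) ℝ))) *
        fromBlocks S.C S.D 0 (noiseD d) := rfl
  rw [hlmi, add_mulVec, dotProduct_add, ← mulVec_mulVec, ← mulVec_mulVec,
    dotProduct_mulVec _ (fromBlocks S.C S.D 0 (noiseD d))ᵀ, vecMul_transpose, hW,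
    fromBlocks_mulVec, fromBlocks_mulVec]
  simp only [Sum.elim_comp_inl, Sum.elim_comp_inr, zero_mulVec, add_zero, zero_add,
    sumElim_dotProduct_sumElim, smul_mulVec, dotProduct_smul, smul_eq_mul, add_mulVec,
    dotProduct_add, add_dotProduct, mulVec_add, ← mulVec_mulVec]
  rw [dotProduct_mulVec ξ S.Aᵀ, vecMul_transpose, dotProduct_mulVec w S.Bᵀ, vecMul_transpose]
  ring

/-- The LMI as a dissipation inequality for the state of one agent and its filters. -/
theorem lmi_dissipation (G : Vehicle nx d nρ) {α m L δ lam : ℝ}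
    {X₀ : Matrix (AgentState nx d ⊕ (Fin ν ⊕ Fin ν) × Fin d)
      (AgentState nx d ⊕ (Fin ν ⊕ Fin ν) × Fin d) ℝ} {H : ℝ} {P₁ P₃ : Fin ν → ℝ}
    {ρ : EuclideanSpace ℝ (Fin nρ)}
    (h : (-(G.lmi ν α m L δ lam X₀ (zfMatrix ν H P₁ P₃) ρ)).PosSemidef)
    (ζ : AgentState nx d → ℝ) (x₁ x₂ : Fin d → Fin ν → ℝ) (u e q r : Fin d → ℝ)
    (hq : ∀ a, q a = u a - m * (G.CG ρ *ᵥ ζ) a) (hr : ∀ a, r a = L * (G.CG ρ *ᵥ ζ) a - u a) :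
    let ξ := agentVec ζ x₁ x₂
    let ξd := agentVec (G.AG ρ *ᵥ ζ + G.BG ρ *ᵥ u + G.BG ρ *ᵥ e)
      (fun a => zfAα ν α *ᵥ x₁ a + zfB ν *ᵥ fun _ => q a)
      (fun a => zfAα ν α *ᵥ x₂ a + zfB ν *ᵥ fun _ => r a)
    ξd ⬝ᵥ X₀ *ᵥ ξ + ξ ⬝ᵥ X₀ *ᵥ ξd + 2 * α * (ξ ⬝ᵥ X₀ *ᵥ ξ) +
      ∑ a, 2 * (H * (q a * r a) - q a * ∑ j, P₃ j * x₂ a j - r a * ∑ j, P₁ j * x₁ a j) +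
      lam * (δ ^ 2 * ∑ a, u a ^ 2 - ∑ a, e a ^ 2) ≤ 0 := by
  intro ξ ξd
  have h1 := h.dotProduct_mulVec_nonneg (Sum.elim ξ (Sum.elim u e))
  rw [star_trivial, neg_mulVec, dotProduct_neg, lmi_quadForm, noise_quadForm,
    kron_one_quadForm] at h1
  simp only [ξ, filtered_dynamics, filtered_output, zfMatrix_quadForm, ← hq, ← hr] at h1
  simp only [ξ, ξd]
  linarith

/-- The chains `filt` with `β = 1 + 2 α` satisfy the state equation of the filter `π`. -/
theorem zfAα_filt (hν : 1 ≤ ν) (α : ℝ) (v : ℝ → ℝ) (t : ℝ) (j : Fin ν) :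
    (zfAα ν α *ᵥ (fun j : Fin ν => filt (1 + 2 * α) v j t) + zfB ν *ᵥ fun _ => v t) j =
      -(1 + 2 * α) * filt (1 + 2 * α) v j t + filtIn (1 + 2 * α) v j t := by
  obtain ⟨k, rfl⟩ : ∃ k, ν = k + 1 := ⟨ν - 1, by omega⟩
  rw [zfAα, sub_mulVec, smul_mulVec, one_mulVec]
  refine Fin.cases ?_ (fun j => ?_) j
  · simp only [Pi.add_apply, Pi.sub_apply, zfA_mulVec_zero]
    simp [mulVec, dotProduct, zfB, filtIn]
    ring
  · simp only [Pi.add_apply, Pi.sub_apply, zfA_mulVec_succ]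
    simp [mulVec, dotProduct, zfB, filtIn]
    ring

end Dissipation

/-! ### Quadratic forms of positive definite matrices -/

section PosDef

variable {n : Type} [Fintype n] [DecidableEq n]

theorem quadForm_le (X : Matrix n n ℝ) (v : EuclideanSpace ℝ n) :
    v.ofLp ⬝ᵥ X *ᵥ v.ofLp ≤ ‖Matrix.toEuclideanCLM (𝕜 := ℝ) X‖ * ‖v‖ ^ 2 := by
  rw [← inner_toEuclideanCLM]
  calc inner ℝ v (Matrix.toEuclideanCLM (𝕜 := ℝ) X v)
      ≤ ‖v‖ * ‖Matrix.toEuclideanCLM (𝕜 := ℝ) X v‖ := real_inner_le_norm _ _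
    _ ≤ ‖v‖ * (‖Matrix.toEuclideanCLM (𝕜 := ℝ) X‖ * ‖v‖) := by
        gcongr; exact ContinuousLinearMap.le_opNorm _ _
    _ = _ := by ring

/-- `‖X⁻¹‖⁻¹` is a lower bound for the quadratic form of a positive definite matrix. -/
theorem norm_sq_le_quadForm {X : Matrix n n ℝ} (hX : X.PosDef) (v : EuclideanSpace ℝ n) :
    ‖v‖ ^ 2 ≤ ‖Matrix.toEuclideanCLM (𝕜 := ℝ) X⁻¹‖ * (v.ofLp ⬝ᵥ X *ᵥ v.ofLp) := by
  set κ := ‖Matrix.toEuclideanCLM (𝕜 := ℝ) X⁻¹‖ with hκ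
  have hκ0 : 0 ≤ κ := norm_nonneg _
  have hdet : IsUnit X.det := hX.det_pos.ne'.isUnit
  set w := X⁻¹ *ᵥ v.ofLp with hw
  have hXw : X *ᵥ w = v.ofLp := by
    rw [hw, mulVec_mulVec, mul_nonsing_inv _ hdet, one_mulVec]
  have hvv : v.ofLp ⬝ᵥ v.ofLp = ‖v‖ ^ 2 := by
    rw [EuclideanSpace.real_norm_sq_eq]
    simp [dotProduct, sq]
  have hwv : w ⬝ᵥ v.ofLp ≤ κ * ‖v‖ ^ 2 := by
    rw [dotProduct_comm]
    exact quadForm_le X⁻¹ v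
  have hsym : w ⬝ᵥ X *ᵥ v.ofLp = ‖v‖ ^ 2 := by
    have hXs : X.IsSymm := by simpa using hX.isHermitian
    have hXt : Xᵀ = X := hXs
    rw [dotProduct_mulVec, ← mulVec_transpose, hXt, hXw, hvv]
  -- positivity of the form at `v - s X⁻¹ v` is the needed Cauchy-Schwarz inequality
  have key : ∀ s : ℝ, 0 ≤ v.ofLp ⬝ᵥ X *ᵥ v.ofLp - 2 * s * ‖v‖ ^ 2 + s ^ 2 * (κ * ‖v‖ ^ 2) := by
    intro s
    have h := hX.posSemidef.dotProduct_mulVec_nonneg (v.ofLp - s • w)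
    rw [star_trivial, mulVec_sub, mulVec_smul, hXw, sub_dotProduct, dotProduct_sub,
      dotProduct_sub, smul_dotProduct, smul_dotProduct, dotProduct_smul, dotProduct_smul, hvv,
      hsym] at h
    simp only [smul_eq_mul] at h
    nlinarith [mul_le_mul_of_nonneg_left hwv (sq_nonneg s)]
  rcases hκ0.eq_or_lt with h0 | h0
  · have h1 := key ((v.ofLp ⬝ᵥ X *ᵥ v.ofLp + 1) / ‖v‖ ^ 2)
    by_cases hv : ‖v‖ ^ 2 = 0
    · rw [hv, ← h0, zero_mul]
    · rw [← h0, mul_assoc 2, div_mul_cancel₀ _ hv] at h1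
      have := key 0
      nlinarith
  · have h1 := mul_le_mul_of_nonneg_left (key (1 / κ)) hκ0
    have h2 : κ * (v.ofLp ⬝ᵥ X *ᵥ v.ofLp - 2 * (1 / κ) * ‖v‖ ^ 2 +
        (1 / κ) ^ 2 * (κ * ‖v‖ ^ 2)) = κ * (v.ofLp ⬝ᵥ X *ᵥ v.ofLp) - ‖v‖ ^ 2 := by
      field_simp; ring
    linarith

theorem condNumber_nonneg (X : Matrix n n ℝ) : 0 ≤ condNumber X :=
  mul_nonneg (norm_nonneg _) (norm_nonneg _)

/-- Decay of the quadratic form yields decay of the norm up to the condition number. -/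
theorem norm_sq_le_condNumber_mul {X : Matrix n n ℝ} (hX : X.PosDef) {v w : EuclideanSpace ℝ n}
    {θ : ℝ} (hθ : 0 ≤ θ) (h : θ * (v.ofLp ⬝ᵥ X *ᵥ v.ofLp) ≤ w.ofLp ⬝ᵥ X *ᵥ w.ofLp) :
    θ * ‖v‖ ^ 2 ≤ condNumber X * ‖w‖ ^ 2 := by
  have hκ : 0 ≤ ‖Matrix.toEuclideanCLM (𝕜 := ℝ) X⁻¹‖ := norm_nonneg _
  calc θ * ‖v‖ ^ 2 ≤ θ * (‖Matrix.toEuclideanCLM (𝕜 := ℝ) X⁻¹‖ * (v.ofLp ⬝ᵥ X *ᵥ v.ofLp)) :=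
        mul_le_mul_of_nonneg_left (norm_sq_le_quadForm hX v) hθ
    _ = ‖Matrix.toEuclideanCLM (𝕜 := ℝ) X⁻¹‖ * (θ * (v.ofLp ⬝ᵥ X *ᵥ v.ofLp)) := by ring
    _ ≤ ‖Matrix.toEuclideanCLM (𝕜 := ℝ) X⁻¹‖ *
        (‖Matrix.toEuclideanCLM (𝕜 := ℝ) X‖ * ‖w‖ ^ 2) :=
        mul_le_mul_of_nonneg_left (h.trans (quadForm_le X w)) hκ
    _ = condNumber X * ‖w‖ ^ 2 := by rw [condNumber]; ring

end PosDef

section QuadForm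

variable {n : Type} [Fintype n]

theorem one_kron_bilinForm {N : ℕ} (X : Matrix n n ℝ) (v w : Fin N × n → ℝ) :
    v ⬝ᵥ ((1 : Matrix (Fin N) (Fin N) ℝ) ⊗ₖ X) *ᵥ w =
      ∑ i, (fun s => v (i, s)) ⬝ᵥ X *ᵥ fun s => w (i, s) := by
  simp only [dotProduct, mulVec, Fintype.sum_prod_type, kronecker_apply]
  refine Finset.sum_congr rfl fun i _ => Finset.sum_congr rfl fun s _ => ?_
  congr 1
  rw [Finset.sum_eq_single i]
  · simp
  · intro k _ hk
    simp [one_apply_ne hk.symm]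
  · simp

theorem hasDerivAt_quadForm (X : Matrix n n ℝ) {v : ℝ → n → ℝ} {v' : n → ℝ} {t : ℝ}
    (h : ∀ s, HasDerivAt (fun t => v t s) (v' s) t) :
    HasDerivAt (fun t => v t ⬝ᵥ X *ᵥ v t) (v' ⬝ᵥ X *ᵥ v t + v t ⬝ᵥ X *ᵥ v') t := by
  have h1 : ∀ s, HasDerivAt (fun t => (X *ᵥ v t) s) ((X *ᵥ v') s) t := fun s => by
    simp only [mulVec, dotProduct]
    exact HasDerivAt.fun_sum fun k _ => (h k).const_mul _
  have h2 : HasDerivAt (fun t => v t ⬝ᵥ X *ᵥ v t)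
      (∑ s, (v' s * (X *ᵥ v t) s + v t s * (X *ᵥ v') s)) t := by
    simp only [dotProduct]
    exact HasDerivAt.fun_sum fun s _ => (h s).mul (h1 s)
  refine h2.congr_deriv ?_
  rw [Finset.sum_add_distrib]
  rfl

theorem absolutelyContinuous_quadForm (X : Matrix n n ℝ) {v : ℝ → n → ℝ} {a b : ℝ}
    (h : ∀ s, AbsolutelyContinuousOnInterval (fun t => v t s) a b) :
    AbsolutelyContinuousOnInterval (fun t => v t ⬝ᵥ X *ᵥ v t) a b := by
  simp only [mulVec, dotProduct]
  exact absolutelyContinuous_sum _ fun s _ => (h s).fun_mul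
    (absolutelyContinuous_sum _ fun k _ => (h k).const_mul _)

end QuadForm

theorem absolutelyContinuous_apply {ι : Type} [Fintype ι] {η : ℝ → EuclideanSpace ℝ ι} {a b : ℝ}
    (h : AbsolutelyContinuousOnInterval η a b) (k : ι) :
    AbsolutelyContinuousOnInterval (fun t => η t k) a b := by
  refine squeeze_zero (fun E => Finset.sum_nonneg fun _ _ => dist_nonneg) (fun E => ?_) h
  refine Finset.sum_le_sum fun i _ => ?_
  rw [Real.dist_eq, EuclideanSpace.dist_eq]
  refine Real.le_sqrt_of_sq_le ?_
  rw [← Real.dist_eq]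
  exact Finset.single_le_sum (f := fun l => dist (η (E.2 i).1 l) (η (E.2 i).2 l) ^ 2)
    (fun _ _ => sq_nonneg _) (Finset.mem_univ k)

theorem blkdiag_mulVec {N : ℕ} {r s : Type} [Fintype s] (M : Fin N → Matrix r s ℝ)
    (v : Fin N × s → ℝ) (i : Fin N) (k : r) :
    (blkdiag M *ᵥ v) (i, k) = (M i *ᵥ fun l => v (i, l)) k := by
  simp only [mulVec, dotProduct, Fintype.sum_prod_type, blkdiag, of_apply]
  rw [Finset.sum_eq_single i]
  · simp
  · intro j _ hj
    simp [hj.symm]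
  · simp

theorem inner_eq_sum {ι : Type} [Fintype ι] (x y : EuclideanSpace ℝ ι) :
    inner ℝ x y = ∑ k, x k * y k := by
  rw [PiLp.inner_apply]
  exact Finset.sum_congr rfl fun k _ => by simp [mul_comm]

/-! ### Exponential decay of the network energy -/

section Network

variable {N nx d nρ ν : ℕ}

/-- The stacked state of all agents, each followed by its filters, in the ordering for which the
energy matrix is `I_N ⊗ X₀`. -/
def networkVec (ζ : Fin N × AgentState nx d → ℝ) (x₁ x₂ : Fin N × Fin d → Fin ν → ℝ) :
    Fin N × (AgentState nx d ⊕ (Fin ν ⊕ Fin ν) × Fin d) → ℝ :=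
  fun k => agentVec (fun s => ζ (k.1, s)) (fun a => x₁ (k.1, a)) (fun a => x₂ (k.1, a)) k.2

/-- The dissipation inequalities of the agents add up; the noise bound removes the term with `λ`. -/
theorem network_dissipation (G : Vehicle nx d nρ) {α m L δ lam : ℝ} (hlam : 0 ≤ lam)
    {X₀ : Matrix (AgentState nx d ⊕ (Fin ν ⊕ Fin ν) × Fin d)
      (AgentState nx d ⊕ (Fin ν ⊕ Fin ν) × Fin d) ℝ} {H : ℝ} {P₁ P₃ : Fin ν → ℝ}
    {ρ : Fin N → EuclideanSpace ℝ (Fin nρ)}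
    (h : ∀ i, (-(G.lmi ν α m L δ lam X₀ (zfMatrix ν H P₁ P₃) (ρ i))).PosSemidef)
    (ζ : Fin N × AgentState nx d → ℝ) (x₁ x₂ : Fin N × Fin d → Fin ν → ℝ)
    (u e q r : Fin N × Fin d → ℝ)
    (hq : ∀ k, q k = u k - m * (blkdiag (fun i => G.CG (ρ i)) *ᵥ ζ) k)
    (hr : ∀ k, r k = L * (blkdiag (fun i => G.CG (ρ i)) *ᵥ ζ) k - u k)
    (hue : ∑ k, e k ^ 2 ≤ δ ^ 2 * ∑ k, u k ^ 2) :
    let ξ := networkVec ζ x₁ x₂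
    let ξd := networkVec (blkdiag (fun i => G.AG (ρ i)) *ᵥ ζ + blkdiag (fun i => G.BG (ρ i)) *ᵥ u +
        blkdiag (fun i => G.BG (ρ i)) *ᵥ e)
      (fun k => zfAα ν α *ᵥ x₁ k + zfB ν *ᵥ fun _ => q k)
      (fun k => zfAα ν α *ᵥ x₂ k + zfB ν *ᵥ fun _ => r k)
    let X := (1 : Matrix (Fin N) (Fin N) ℝ) ⊗ₖ X₀
    ξd ⬝ᵥ X *ᵥ ξ + ξ ⬝ᵥ X *ᵥ ξd + 2 * α * (ξ ⬝ᵥ X *ᵥ ξ) +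
      2 * ∑ k, (H * (q k * r k) - q k * ∑ j, P₃ j * x₂ k j - r k * ∑ j, P₁ j * x₁ k j) ≤ 0 := by
  intro ξ ξd X
  have hbil : ∀ v w : Fin N × (AgentState nx d ⊕ (Fin ν ⊕ Fin ν) × Fin d) → ℝ,
      v ⬝ᵥ X *ᵥ w = ∑ i, (fun s => v (i, s)) ⬝ᵥ X₀ *ᵥ fun s => w (i, s) :=
    one_kron_bilinForm X₀
  have h1 : ∀ i, _ := fun i => lmi_dissipation G (h i) (fun s => ζ (i, s))
    (fun a => x₁ (i, a)) (fun a => x₂ (i, a)) (fun a => u (i, a)) (fun a => e (i, a))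
    (fun a => q (i, a)) (fun a => r (i, a))
    (fun a => by rw [hq, blkdiag_mulVec]) (fun a => by rw [hr, blkdiag_mulVec])
  have h2 := Finset.sum_nonpos fun i (_ : i ∈ Finset.univ) => h1 i
  simp only [Finset.sum_add_distrib, ← Finset.mul_sum, Finset.sum_sub_distrib] at h2
  have hξd : ∀ i, (fun s => ξd (i, s)) = agentVec
      (G.AG (ρ i) *ᵥ (fun s => ζ (i, s)) + G.BG (ρ i) *ᵥ (fun a => u (i, a)) +
        G.BG (ρ i) *ᵥ fun a => e (i, a))
      (fun a => zfAα ν α *ᵥ x₁ (i, a) + zfB ν *ᵥ fun _ => q (i, a))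
      (fun a => zfAα ν α *ᵥ x₂ (i, a) + zfB ν *ᵥ fun _ => r (i, a)) := by
    intro i
    simp only [ξd, networkVec]
    ext s
    simp only [Pi.add_apply, blkdiag_mulVec]
    rfl
  have hnoise : 0 ≤ lam * (δ ^ 2 * ∑ k, u k ^ 2 - ∑ k, e k ^ 2) :=
    mul_nonneg hlam (by linarith)
  rw [hbil, hbil, hbil]
  simp only [hξd]
  simp only [Fintype.sum_prod_type, Finset.sum_sub_distrib, ← Finset.mul_sum] at hnoise ⊢
  simp only [ξ, networkVec]
  linarith

/-- The energy estimate: as long as the scheduling parameters stay in the set where the LMI holds,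
the energy of plant and filter states decays with rate `2 α`. -/
theorem energy_decay (hν : 1 ≤ ν) (G : Vehicle nx d nρ) {Ps : Set (EuclideanSpace ℝ (Fin nρ))}
    {m L δ : ℝ} (hmL : m ≤ L)
    {f : EuclideanSpace ℝ (Fin N × Fin d) → ℝ} (hf : f ∈ SectorClass m L)
    {ηs : EuclideanSpace ℝ (Fin N × AgentState nx d)} {ys : EuclideanSpace ℝ (Fin N × Fin d)}
    (heq : IsEquilibrium G Ps f ηs ys)
    {g : EuclideanSpace ℝ (Fin N × AgentState nx d) → Fin N → EuclideanSpace ℝ (Fin nρ)}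
    {X₀ : Matrix (AgentState nx d ⊕ (Fin ν ⊕ Fin ν) × Fin d)
      (AgentState nx d ⊕ (Fin ν ⊕ Fin ν) × Fin d) ℝ} {H : ℝ} {P₁ P₃ : Fin ν → ℝ}
    (hP₁ : ∀ t : ℝ, 0 ≤ t → 0 ≤ ∑ j : Fin ν, P₁ j * (t ^ (j : ℕ) / (Nat.factorial (j : ℕ) : ℝ)))
    (hP₃ : ∀ t : ℝ, 0 ≤ t → 0 ≤ ∑ j : Fin ν, P₃ j * (t ^ (j : ℕ) / (Nat.factorial (j : ℕ) : ℝ)))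
    (hH : ∑ j, P₁ j + ∑ j, P₃ j ≤ H)
    {lam : ℝ} (hlam : 0 ≤ lam) {α : ℝ} (hα : 0 < α)
    (hLMI : ∀ ρ ∈ Ps, (-(G.lmi ν α m L δ lam X₀ (zfMatrix ν H P₁ P₃) ρ)).PosSemidef)
    {η₀ : EuclideanSpace ℝ (Fin N × AgentState nx d)}
    {η : ℝ → EuclideanSpace ℝ (Fin N × AgentState nx d)}
    {u e y : ℝ → EuclideanSpace ℝ (Fin N × Fin d)}
    {ρ : ℝ → Fin N → EuclideanSpace ℝ (Fin nρ)}
    (htraj : IsTrajectory G g f η₀ η u e y ρ) (hnoise : NoiseBound δ f e y)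
    {T : ℝ} (hT : 0 ≤ T) (hρ : ∀ t ∈ Set.Ioo 0 T, ∀ i, ρ t i ∈ Ps) :
    ∃ x₁ x₂ : Fin N × Fin d → Fin ν → ℝ,
      let X := (1 : Matrix (Fin N) (Fin N) ℝ) ⊗ₖ X₀
      let ξ := networkVec (η T - ηs).ofLp x₁ x₂
      let ξ₀ := networkVec (η₀ - ηs).ofLp (0 : Fin N × Fin d → Fin ν → ℝ)
        (0 : Fin N × Fin d → Fin ν → ℝ)
      Real.exp (2 * α * T) * (ξ ⬝ᵥ X *ᵥ ξ) ≤ ξ₀ ⬝ᵥ X *ᵥ ξ₀ := by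
  have hgrad0 : gradient f ys = 0 := gradient_minimizer heq.minimizer
  -- signals entering the filters and the potentials along the trajectory
  let q : Fin N × Fin d → ℝ → ℝ := fun k t => sectorLow f m ys (y t) k
  let r : Fin N × Fin d → ℝ → ℝ := fun k t => sectorUp f L ys (y t) k
  let ψ₁ : ℝ → ℝ := fun t => lowPotential f m L ys (y t)
  let ψ₃ : ℝ → ℝ := fun t => upPotential f m L ys (y t)
  let x₁ : ℝ → Fin N × Fin d → Fin ν → ℝ := fun t k j => filt (1 + 2 * α) (q k) j t
  let x₂ : ℝ → Fin N × Fin d → Fin ν → ℝ := fun t k j => filt (1 + 2 * α) (r k) j t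
  let X := (1 : Matrix (Fin N) (Fin N) ℝ) ⊗ₖ X₀
  let ξ := fun t => networkVec (η t - ηs).ofLp (x₁ t) (x₂ t)
  -- integrability
  have hymeas : AEStronglyMeasurable y (volume.restrict (Set.Icc 0 T)) := (htraj.y_mem T hT).1
  have hyL2 : MemLp (fun t => y t - ys) 2 (volume.restrict (Set.Icc 0 T)) :=
    (htraj.y_mem T hT).sub (memLp_const ys)
  have huL2 : MemLp (fun t => gradient f (y t)) 2 (volume.restrict (Set.Icc 0 T)) := by
    refine (htraj.u_mem T hT).ae_eq ?_
    rw [Filter.EventuallyEq, ae_restrict_iff' measurableSet_Icc]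
    exact Filter.Eventually.of_forall fun t ht => htraj.input t ht.1
  have hqL2 : MemLp (fun t => sectorLow f m ys (y t)) 2 (volume.restrict (Set.Icc 0 T)) :=
    huL2.sub (hyL2.const_smul m)
  have hrL2 : MemLp (fun t => sectorUp f L ys (y t)) 2 (volume.restrict (Set.Icc 0 T)) :=
    (hyL2.const_smul L).sub huL2
  have hcoord : ∀ s : ℝ → EuclideanSpace ℝ (Fin N × Fin d),
      MemLp s 2 (volume.restrict (Set.Icc 0 T)) → ∀ k,
      IntervalIntegrable (fun t => s t k) volume 0 T := by
    intro s hs k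
    rw [intervalIntegrable_iff_integrableOn_Icc_of_le hT]
    have h1 : Integrable s (volume.restrict (Set.Icc 0 T)) := hs.integrable (by norm_num)
    exact (EuclideanSpace.proj k : EuclideanSpace ℝ (Fin N × Fin d) →L[ℝ] ℝ).integrable_comp h1
  have hqi : ∀ k, IntervalIntegrable (q k) volume 0 T := hcoord _ hqL2
  have hri : ∀ k, IntervalIntegrable (r k) volume 0 T := hcoord _ hrL2
  have hpot : ∀ ψ : EuclideanSpace ℝ (Fin N × Fin d) → ℝ, Continuous ψ → (∀ x, 0 ≤ ψ x) →
      (∀ x, ψ x ≤ inner ℝ (sectorUp f L ys x) (sectorLow f m ys x)) →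
      IntervalIntegrable (fun t => ψ (y t)) volume 0 T := by
    intro ψ hc h0 hle
    rw [intervalIntegrable_iff_integrableOn_Icc_of_le hT]
    have hb : Integrable (fun t => ‖sectorUp f L ys (y t)‖ ^ 2 + ‖sectorLow f m ys (y t)‖ ^ 2)
        (volume.restrict (Set.Icc 0 T)) :=
      (hrL2.integrable_norm_pow (by norm_num)).add (hqL2.integrable_norm_pow (by norm_num))
    refine hb.mono' (hc.comp_aestronglyMeasurable hymeas) (Filter.Eventually.of_forall fun t => ?_)
    rw [Real.norm_of_nonneg (h0 _)]
    have h1 := (hle (y t)).trans (real_inner_le_norm _ _)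
    nlinarith [sq_nonneg (‖sectorUp f L ys (y t)‖ - ‖sectorLow f m ys (y t)‖),
      sq_nonneg ‖sectorUp f L ys (y t)‖, sq_nonneg ‖sectorLow f m ys (y t)‖]
  have hψ₁ : IntervalIntegrable ψ₁ volume 0 T :=
    hpot _ (continuous_lowPotential hf) (lowPotential_nonneg hmL hf hgrad0)
      (lowPotential_le hmL hf hgrad0)
  have hψ₃ : IntervalIntegrable ψ₃ volume 0 T :=
    hpot _ (continuous_upPotential hf) (upPotential_nonneg hmL hf hgrad0) fun x => by
      rw [real_inner_comm]; exact upPotential_le hmL hf hgrad0 x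
  have hξac : ∀ s, AbsolutelyContinuousOnInterval (fun t => ξ t s) 0 T := by
    rintro ⟨i, s | ⟨j | j, a⟩⟩
    · exact (absolutelyContinuous_apply (htraj.absCont T hT) (i, s)).fun_sub
        (absolutelyContinuous_const (ηs (i, s)) 0 T)
    · exact filt_absolutelyContinuous _ (hqi (i, a)) j
    · exact filt_absolutelyContinuous _ (hri (i, a)) j
  let F : ℝ → ℝ := fun t => Real.exp (2 * α * t) * (ξ t ⬝ᵥ X *ᵥ ξ t) +
    2 * (zfStorage α P₁ ψ₁ t + zfStorage α P₃ ψ₃ t)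
  have hFac : AbsolutelyContinuousOnInterval F 0 T := by
    refine AbsolutelyContinuousOnInterval.fun_add ?_ ?_
    · refine AbsolutelyContinuousOnInterval.fun_mul ?_ (absolutelyContinuous_quadForm X hξac)
      exact ContDiffOn.absolutelyContinuousOnInterval (by fun_prop)
    · exact ((zfStorage_absolutelyContinuous α P₁ hψ₁).fun_add
        (zfStorage_absolutelyContinuous α P₃ hψ₃)).const_mul 2
  have hFle : F T ≤ F 0 := by
    refine le_of_ae_hasDerivAt_nonpos hT hFac ?_
    have hdyn := htraj.dynamics
    rw [ae_restrict_iff' measurableSet_Ici] at hdyn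
    filter_upwards [hdyn, zfStorage_ae_hasDerivAt α P₁ hψ₁, zfStorage_ae_hasDerivAt α P₃ hψ₃,
      ae_all_iff.2 fun k => ae_all_iff.2 fun j : ℕ => filt_ae_hasDerivAt (1 + 2 * α) (hqi k) j,
      ae_all_iff.2 fun k => ae_all_iff.2 fun j : ℕ => filt_ae_hasDerivAt (1 + 2 * α) (hri k) j]
      with t hη h₁ h₃ hx₁ hx₂ ht
    have ht0 : 0 ≤ t := ht.1.le
    have htu : t ∈ Set.uIcc 0 T := by rw [Set.uIcc_of_le hT]; exact ⟨ht0, ht.2.le⟩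
    have hsub : Set.uIcc 0 t ⊆ Set.uIcc 0 T := Set.uIcc_subset_uIcc_left htu
    have hstate := heq.state (ρ t) (hρ t ht)
    have houtput := heq.output (ρ t) (hρ t ht)
    have hyt : (y t - ys).ofLp = blkdiag (fun i => G.CG (ρ t i)) *ᵥ (η t - ηs).ofLp := by
      rw [WithLp.ofLp_sub, WithLp.ofLp_sub, mulVec_sub, ← houtput, htraj.output t ht0]
    -- the derivative of the stacked state
    let ξd := networkVec (blkdiag (fun i => G.AG (ρ t i)) *ᵥ (η t - ηs).ofLp +
        blkdiag (fun i => G.BG (ρ t i)) *ᵥ (u t).ofLp +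
        blkdiag (fun i => G.BG (ρ t i)) *ᵥ (e t).ofLp)
      (fun k => zfAα ν α *ᵥ x₁ t k + zfB ν *ᵥ fun _ => q k t)
      (fun k => zfAα ν α *ᵥ x₂ t k + zfB ν *ᵥ fun _ => r k t)
    have hξd : ∀ s, HasDerivAt (fun t => ξ t s) (ξd s) t := by
      rintro ⟨i, s | ⟨j | j, a⟩⟩
      · have h := ((EuclideanSpace.proj (i, s) :
          EuclideanSpace ℝ (Fin N × AgentState nx d) →L[ℝ] ℝ).hasFDerivAt.comp_hasDerivAt t
            (hη ht0)).sub_const (ηs (i, s))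
        refine h.congr_deriv ?_
        simp only [ξd, networkVec, agentVec, Sum.elim_inl]
        rw [WithLp.ofLp_sub, mulVec_sub, hstate, sub_zero]
        rfl
      · refine (hx₁ (i, a) j htu).congr_deriv ?_
        exact (zfAα_filt hν α (q (i, a)) t j).symm
      · refine (hx₂ (i, a) j htu).congr_deriv ?_
        exact (zfAα_filt hν α (r (i, a)) t j).symm
    have hexp : HasDerivAt (fun t => Real.exp (2 * α * t)) (2 * α * Real.exp (2 * α * t)) t := by
      refine ((hasDerivAt_id t).const_mul (2 * α)).exp.congr_deriv ?_
      simp only [id, mul_one]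
      ring
    refine ⟨_, ?_, (hexp.mul (hasDerivAt_quadForm X hξd)).add
      (((h₁ htu).add (h₃ htu)).const_mul 2)⟩
    -- the supply rate
    have hut : u t = gradient f (y t) := htraj.input t ht0
    have hnoise_t : ∑ k, e t k ^ 2 ≤ δ ^ 2 * ∑ k, u t k ^ 2 := by
      rw [← EuclideanSpace.real_norm_sq_eq, ← EuclideanSpace.real_norm_sq_eq, hut, ← mul_pow]
      exact pow_le_pow_left₀ (norm_nonneg _) (hnoise t ht0) 2
    have hdiss := network_dissipation G hlam (fun i => hLMI (ρ t i) (hρ t ht i))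
      (η t - ηs).ofLp (x₁ t) (x₂ t) (u t).ofLp (e t).ofLp (fun k => q k t) (fun k => r k t)
      (fun k => by
        rw [← hyt, hut]
        simp [q, sectorLow])
      (fun k => by
        rw [← hyt, hut]
        simp [r, sectorUp]) hnoise_t
    have hβ : 1 ≤ 1 + 2 * α := by linarith
    have hzf₁ := zamesFalb_pointwise (ψ := ψ₁) (r := fun k => r k t) hP₁ hβ ht0
      (fun k => (hqi k).mono_set hsub) (hψ₁.mono_set hsub)
      (fun s _ => by
        have := lowPotential_sub_le hmL hf ys (y t) (y s)
        rwa [inner_eq_sum] at this)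
      (by
        have := lowPotential_le hmL hf hgrad0 (y t)
        rwa [inner_eq_sum] at this)
    have hzf₃ := zamesFalb_pointwise (ψ := ψ₃) (r := fun k => q k t) hP₃ hβ ht0
      (fun k => (hri k).mono_set hsub) (hψ₃.mono_set hsub)
      (fun s _ => by
        have := upPotential_sub_le hmL hf ys (y t) (y s)
        rwa [inner_eq_sum] at this)
      (by
        have := upPotential_le hmL hf hgrad0 (y t)
        rwa [inner_eq_sum] at this)
    have hqr : 0 ≤ ∑ k, q k t * r k t := by
      have h1 := (upPotential_nonneg hmL hf hgrad0 (y t)).trans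
        (upPotential_le hmL hf hgrad0 (y t))
      rwa [inner_eq_sum] at h1
    have hsupply : (∑ j, P₁ j) * ψ₁ t - ∑ j, P₁ j * filt (1 + 2 * α) ψ₁ j t +
        ((∑ j, P₃ j) * ψ₃ t - ∑ j, P₃ j * filt (1 + 2 * α) ψ₃ j t) ≤
        ∑ k, (H * (q k t * r k t) - q k t * ∑ j, P₃ j * x₂ t k j -
          r k t * ∑ j, P₁ j * x₁ t k j) := by
      refine (add_le_add hzf₁ hzf₃).trans ?_
      have e1 : ∑ k, r k t * ((∑ j, P₁ j) * q k t - ∑ j, P₁ j * filt (1 + 2 * α) (q k) j t) +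
          ∑ k, q k t * ((∑ j, P₃ j) * r k t - ∑ j, P₃ j * filt (1 + 2 * α) (r k) j t) =
          (∑ j, P₁ j + ∑ j, P₃ j) * ∑ k, q k t * r k t +
            ∑ k, (- (q k t * ∑ j, P₃ j * x₂ t k j) - r k t * ∑ j, P₁ j * x₁ t k j) := by
        rw [← Finset.sum_add_distrib, Finset.mul_sum, ← Finset.sum_add_distrib]
        exact Finset.sum_congr rfl fun k _ => by simp only [x₁, x₂]; ring
      have e2 : ∑ k, (H * (q k t * r k t) - q k t * ∑ j, P₃ j * x₂ t k j -
          r k t * ∑ j, P₁ j * x₁ t k j) = H * ∑ k, q k t * r k t +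
            ∑ k, (- (q k t * ∑ j, P₃ j * x₂ t k j) - r k t * ∑ j, P₁ j * x₁ t k j) := by
        rw [Finset.mul_sum, ← Finset.sum_add_distrib]
        exact Finset.sum_congr rfl fun k _ => by ring
      rw [e1, e2]
      have := mul_le_mul_of_nonneg_right hH hqr
      linarith
    have hE : 0 < Real.exp (2 * α * t) := Real.exp_pos _
    have hfinal := mul_nonpos_of_nonneg_of_nonpos hE.le hdiss
    have hfinal2 := mul_le_mul_of_nonneg_left hsupply hE.le
    -- identify the derivative found above, then combine the weighted supply inequalities
    change 2 * α * Real.exp (2 * α * t) * (ξ t ⬝ᵥ X *ᵥ ξ t) +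
      Real.exp (2 * α * t) * (ξd ⬝ᵥ X *ᵥ ξ t + ξ t ⬝ᵥ X *ᵥ ξd) + _ ≤ 0
    change Real.exp (2 * α * t) * (ξd ⬝ᵥ X *ᵥ ξ t + ξ t ⬝ᵥ X *ᵥ ξd +
      2 * α * (ξ t ⬝ᵥ X *ᵥ ξ t) + 2 * _) ≤ 0 at hfinal
    linarith
  refine ⟨x₁ T, x₂ T, ?_⟩
  change Real.exp (2 * α * T) * (ξ T ⬝ᵥ X *ᵥ ξ T) ≤ _
  have hξ0 : ξ 0 = networkVec (η₀ - ηs).ofLp (0 : Fin N × Fin d → Fin ν → ℝ)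
      (0 : Fin N × Fin d → Fin ν → ℝ) := by
    have e1 : x₁ 0 = 0 := by ext k j; exact filt_zero _ _ _
    have e2 : x₂ 0 = 0 := by ext k j; exact filt_zero _ _ _
    simp only [ξ, e1, e2, htraj.init]
  have hF0 : F 0 = ξ 0 ⬝ᵥ X *ᵥ ξ 0 := by
    simp only [F, zfStorage_zero]
    simp
  have hs₁ := zfStorage_nonneg α hP₁ hT hψ₁ fun s _ => lowPotential_nonneg hmL hf hgrad0 (y s)
  have hs₃ := zfStorage_nonneg α hP₃ hT hψ₃ fun s _ => upPotential_nonneg hmL hf hgrad0 (y s)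
  rw [hF0, hξ0] at hFle
  simp only [F] at hFle
  linarith

/-- The state deviation is bounded by the stacked state. -/
theorem norm_sq_le_networkVec (v : EuclideanSpace ℝ (Fin N × AgentState nx d))
    (x₁ x₂ : Fin N × Fin d → Fin ν → ℝ) :
    ‖v‖ ^ 2 ≤ ‖WithLp.toLp 2 (networkVec v.ofLp x₁ x₂)‖ ^ 2 := by
  rw [EuclideanSpace.real_norm_sq_eq, EuclideanSpace.real_norm_sq_eq, Fintype.sum_prod_type,
    Fintype.sum_prod_type]
  refine Finset.sum_le_sum fun i _ => ?_
  rw [Fintype.sum_sum_type fun k => (WithLp.toLp 2 (networkVec v.ofLp x₁ x₂)) (i, k) ^ 2]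
  simp only [networkVec, agentVec, Sum.elim_inl]
  exact le_add_of_nonneg_right (Finset.sum_nonneg fun _ _ => sq_nonneg _)

theorem norm_sq_networkVec_zero (v : EuclideanSpace ℝ (Fin N × AgentState nx d)) :
    ‖WithLp.toLp 2 (networkVec v.ofLp (0 : Fin N × Fin d → Fin ν → ℝ)
      (0 : Fin N × Fin d → Fin ν → ℝ))‖ ^ 2 = ‖v‖ ^ 2 := by
  rw [EuclideanSpace.real_norm_sq_eq, EuclideanSpace.real_norm_sq_eq, Fintype.sum_prod_type,
    Fintype.sum_prod_type]
  refine Finset.sum_congr rfl fun i _ => ?_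
  rw [Fintype.sum_sum_type]
  simp only [networkVec, agentVec, Sum.elim_inl, Sum.elim_inr, add_eq_left]
  refine Finset.sum_eq_zero fun k _ => ?_
  rcases k with ⟨j | j, a⟩ <;> simp

/-- Bounded output matrices give a uniform output gain. -/
theorem output_gain (G : Vehicle nx d nρ) {Ps : Set (EuclideanSpace ℝ (Fin nρ))}
    {K : ℝ} (hK : ∀ ρ ∈ Ps, ∀ i j, |G.C ρ i j| ≤ K) :
    ∃ M : ℝ, 0 ≤ M ∧ ∀ ρ : Fin N → EuclideanSpace ℝ (Fin nρ), (∀ i, ρ i ∈ Ps) →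
      ∀ (v : EuclideanSpace ℝ (Fin N × AgentState nx d)) (w : EuclideanSpace ℝ (Fin N × Fin d)),
        w.ofLp = blkdiag (fun i => G.CG (ρ i)) *ᵥ v.ofLp → ‖w‖ ≤ M * ‖v‖ := by
  refine ⟨∑ _k : Fin N × Fin d, ∑ _l : Fin nx, |K|,
    Finset.sum_nonneg fun _ _ => Finset.sum_nonneg fun _ _ => abs_nonneg K,
    fun ρ hρ v w hw => ?_⟩
  have hcoord : ∀ k, |w k| ≤ (∑ _l : Fin nx, |K|) * ‖v‖ := by
    rintro ⟨i, a⟩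
    have h1 : w (i, a) = ∑ l, G.C (ρ i) a l * v (i, Sum.inl l) := by
      rw [show w (i, a) = w.ofLp (i, a) from rfl, hw, blkdiag_mulVec]
      simp only [Vehicle.CG, mulVec, dotProduct, Fintype.sum_sum_type]
      simp
    rw [h1, Finset.sum_mul]
    refine (Finset.abs_sum_le_sum_abs _ _).trans (Finset.sum_le_sum fun l _ => ?_)
    rw [abs_mul]
    exact mul_le_mul ((hK _ (hρ i) a l).trans (le_abs_self K))
      (by simpa using PiLp.norm_apply_le v (i, Sum.inl l)) (abs_nonneg _) (abs_nonneg _)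
  have hsum : ‖w‖ ≤ ∑ k, |w k| := by
    have h2 : w = ∑ k, EuclideanSpace.single k (w k) := by
      ext l
      simp [Finset.sum_apply]
    calc ‖w‖ = ‖∑ k, EuclideanSpace.single k (w k)‖ := by rw [← h2]
      _ ≤ ∑ k, ‖EuclideanSpace.single k (w k)‖ := norm_sum_le _ _
      _ = ∑ k, |w k| := by simp
  refine hsum.trans ?_
  rw [Finset.sum_mul]
  exact Finset.sum_le_sum fun k _ => hcoord k

end Network

end SourceSeeking

end

open SourceSeeking Matrix MeasureTheory
open scoped Kronecker

theorem theorem2 (N nx d nρ ν : ℕ) (hν : 1 ≤ ν)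
    (G : Vehicle nx d nρ) (Ps : Set (EuclideanSpace ℝ (Fin nρ)))
    (hC : ∃ K : ℝ, ∀ ρ ∈ Ps, ∀ i j, |G.C ρ i j| ≤ K)
    (m L δ : ℝ) (hm : 0 < m) (hmL : m ≤ L) (hδ : 0 ≤ δ)
    (f : EuclideanSpace ℝ (Fin N × Fin d) → ℝ) (hf : f ∈ SectorClass m L)
    (ηs : EuclideanSpace ℝ (Fin N × AgentState nx d))
    (ys : EuclideanSpace ℝ (Fin N × Fin d))
    (heq : IsEquilibrium G Ps f ηs ys)
    (g : EuclideanSpace ℝ (Fin N × AgentState nx d) → Fin N → EuclideanSpace ℝ (Fin nρ))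
    (c : ℝ) (hc : 0 ≤ c)
    (hg : Metric.closedBall ηs c ⊆ {η | ∀ i, g η i ∈ Ps})
    (X₀ : Matrix (AgentState nx d ⊕ (Fin ν ⊕ Fin ν) × Fin d)
      (AgentState nx d ⊕ (Fin ν ⊕ Fin ν) × Fin d) ℝ) (hX₀ : X₀.PosDef)
    (P : Matrix (PiOut ν ⊕ PiOut ν) (PiOut ν ⊕ PiOut ν) ℝ) (hP : P ∈ ZFSet ν)
    (lam : ℝ) (hlam : 0 ≤ lam) (α : ℝ) (hα : 0 < α)
    (hLMI : ∀ ρ ∈ Ps, (-(G.lmi ν α m L δ lam X₀ P ρ)).PosSemidef)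
    (η₀ : EuclideanSpace ℝ (Fin N × AgentState nx d))
    (hη₀ : ‖η₀ - ηs‖ <
      c / Real.sqrt (condNumber ((1 : Matrix (Fin N) (Fin N) ℝ) ⊗ₖ X₀)))
    (η : ℝ → EuclideanSpace ℝ (Fin N × AgentState nx d))
    (u e y : ℝ → EuclideanSpace ℝ (Fin N × Fin d))
    (ρ : ℝ → Fin N → EuclideanSpace ℝ (Fin nρ))
    (htraj : IsTrajectory G g f η₀ η u e y ρ)
    (hnoise : NoiseBound δ f e y) :
    (∀ t : ℝ, 0 ≤ t → ‖η t - ηs‖ < c) ∧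
      ∃ κ : ℝ, 0 ≤ κ ∧ ∀ t : ℝ, 0 ≤ t → ‖y t - ys‖ ≤ κ * Real.exp (-α * t) := by
  obtain ⟨H, P₁, P₃, X₁, X₃, hX₁, hX₃, hH, hpos₁, hpos₃, rfl⟩ := hP
  have hH' : ∑ j, P₁ j + ∑ j, P₃ j ≤ H := by
    simp only [zfA_inv_mul_zfB hν, mul_neg_one, Finset.sum_neg_distrib,
      Finset.sum_add_distrib] at hH
    linarith
  set X := (1 : Matrix (Fin N) (Fin N) ℝ) ⊗ₖ X₀ with hX
  have hXpos : X.PosDef := PosDef.one.kronecker hX₀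
  set κ := condNumber X with hκ
  have hκ0 : 0 ≤ κ := condNumber_nonneg X
  have hball : ∀ t, 0 ≤ t → ‖η t - ηs‖ ≤ c → ∀ i, ρ t i ∈ Ps := by
    intro t ht hle i
    rw [htraj.scheduling t ht]
    exact hg (mem_closedBall_iff_norm.2 hle) i
  have hdecay : ∀ T, 0 ≤ T → (∀ t ∈ Set.Ioo 0 T, ‖η t - ηs‖ ≤ c) →
      Real.exp (2 * α * T) * ‖η T - ηs‖ ^ 2 ≤ κ * ‖η₀ - ηs‖ ^ 2 := by
    intro T hT hin
    obtain ⟨x₁, x₂, h⟩ := energy_decay hν G hmL hf heq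
      (fun t ht => posLMI_polynomial_nonneg hν hX₁ hpos₁ ht)
      (fun t ht => posLMI_polynomial_nonneg hν hX₃ hpos₃ ht) hH' hlam hα hLMI htraj hnoise hT
      (fun t ht => hball t ht.1.le (hin t ht))
    have h1 := norm_sq_le_condNumber_mul hXpos
      (v := WithLp.toLp 2 (networkVec (η T - ηs).ofLp x₁ x₂))
      (w := WithLp.toLp 2 (networkVec (η₀ - ηs).ofLp (0 : Fin N × Fin d → Fin ν → ℝ)
        (0 : Fin N × Fin d → Fin ν → ℝ))) (Real.exp_pos _).le h
    rw [norm_sq_networkVec_zero] at h1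
    exact (mul_le_mul_of_nonneg_left (norm_sq_le_networkVec _ x₁ x₂) (Real.exp_pos _).le).trans h1
  -- `c / √κ` would be the junk value `0` for `κ = 0`, which `hη₀` excludes
  have hκpos : 0 < Real.sqrt κ := by
    refine (Real.sqrt_nonneg κ).lt_of_ne fun h0 => ?_
    rw [← h0, div_zero] at hη₀
    exact absurd hη₀ (not_lt.2 (norm_nonneg _))
  have hinit : κ * ‖η₀ - ηs‖ ^ 2 < c ^ 2 := by
    rw [lt_div_iff₀ hκpos] at hη₀
    have := pow_lt_pow_left₀ hη₀ (by positivity) two_ne_zero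
    rw [mul_pow, Real.sq_sqrt hκ0] at this
    linarith
  have hinv : ∀ t : ℝ, 0 ≤ t → ‖η t - ηs‖ < c := by
    intro t₁ ht₁
    by_contra! hge
    -- the first time at which the trajectory leaves the open ball
    have hcont : ContinuousOn (fun t => ‖η t - ηs‖) (Set.Icc 0 t₁) := by
      have := (htraj.absCont t₁ ht₁).continuousOn
      rw [Set.uIcc_of_le ht₁] at this
      exact (this.sub continuousOn_const).norm
    have hcomp : IsCompact (Set.Icc 0 t₁ ∩ (fun t => ‖η t - ηs‖) ⁻¹' Set.Ici c) :=
      isCompact_Icc.of_isClosed_subset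
        (hcont.preimage_isClosed_of_isClosed isClosed_Icc isClosed_Ici) Set.inter_subset_left
    obtain ⟨T, ⟨hTmem, hTc⟩, hleast⟩ := hcomp.exists_isLeast ⟨t₁, ⟨ht₁, le_rfl⟩, hge⟩
    have hTc' : c ≤ ‖η T - ηs‖ := hTc
    have h1 := hdecay T hTmem.1 fun t ht => by
      by_contra! hlt
      exact absurd (hleast ⟨⟨ht.1.le, ht.2.le.trans hTmem.2⟩, hlt.le⟩) (not_le.2 ht.2)
    have h2 : 1 ≤ Real.exp (2 * α * T) :=
      Real.one_le_exp (mul_nonneg (by linarith) hTmem.1)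
    have h3 : c ^ 2 ≤ ‖η T - ηs‖ ^ 2 := pow_le_pow_left₀ hc hTc' 2
    nlinarith [sq_nonneg ‖η T - ηs‖]
  refine ⟨hinv, ?_⟩
  obtain ⟨K, hK⟩ := hC
  obtain ⟨M, hM, hgain⟩ := output_gain (N := N) G hK
  refine ⟨M * (Real.sqrt κ * ‖η₀ - ηs‖), by positivity, fun t ht => ?_⟩
  have hρt : ∀ i, ρ t i ∈ Ps := hball t ht (hinv t ht).le
  have hyt : (y t - ys).ofLp = blkdiag (fun i => G.CG (ρ t i)) *ᵥ (η t - ηs).ofLp := by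
    rw [WithLp.ofLp_sub, WithLp.ofLp_sub, mulVec_sub, ← heq.output (ρ t) hρt, htraj.output t ht]
  have h1 := hdecay t ht fun s hs => (hinv s hs.1.le).le
  have h2 : Real.exp (α * t) * ‖η t - ηs‖ ≤ Real.sqrt κ * ‖η₀ - ηs‖ := by
    refine le_of_sq_le_sq ?_ (by positivity)
    have hexp : Real.exp (α * t) ^ 2 = Real.exp (2 * α * t) := by
      rw [← Real.exp_nat_mul, Nat.cast_ofNat, mul_assoc]
    rw [mul_pow, mul_pow, Real.sq_sqrt hκ0, hexp]
    exact h1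
  have h3 : ‖η t - ηs‖ ≤ Real.sqrt κ * ‖η₀ - ηs‖ * Real.exp (-α * t) := by
    have : ‖η t - ηs‖ = Real.exp (α * t) * ‖η t - ηs‖ * Real.exp (-α * t) := by
      rw [mul_right_comm, ← Real.exp_add]
      simp
    rw [this]
    gcongr
  calc ‖y t - ys‖ ≤ M * ‖η t - ηs‖ := hgain (ρ t) hρt _ _ hyt
    _ ≤ M * (Real.sqrt κ * ‖η₀ - ηs‖ * Real.exp (-α * t)) := by gcongr
    _ = M * (Real.sqrt κ * ‖η₀ - ηs‖) * Real.exp (-α * t) := by ring
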